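/- \textbf{Setting.} Let $m\ge 2$ senders and one receiver $r$ play an $n$-stage game. The state is $x_k=Ax_{k-1}+w_{k-1}\in\mathbb R^p$, $k=1,\dots,n$, where $x_0\sim N(0,\Sigma_0)$ and $w_k\sim N(0,\Sigma_w)$ are independent, so $x_k$ has covariance $\Sigma_k=A\Sigma_{k-1}A^\top+\Sigma_w$. At stage $k$ sender $i$ sends $y^i_k=\eta^i_k(x_1,\dots,x_k)\in\mathbb R^p$, and the receiver plays $u_k=\gamma_k\big((y^i_j)_{i\le m,\,j\le k}\big)\in\mathbb R^t$; all policies are Borel. Player $j\in\{1,\dots,m,r\}$ has stage cost $\|Q_{j,k}x_k+R_{j,k}u_k\|^2$ and minimizes the expected sum of its stage costs; $R_{r,k}^\top R_{r,k}$ is invertible. In a multistage hierarchical Nash equilibrium the receiver answers every profile of sender policies with a best response and no sender gains by a unilateral deviation to which the receiver responds; both are required for the costs of stages $1,\dots,K$, for every $K\le n$. The posterior covariance at stage $k$ is $\mathbb E[\hat x_k\hat x_k^\top]$ with $\hat x_k=\mathbb E[x_k\mid (y^i_j)_{i\le m,\,j\le k}]$. Put $\Lambda^i_k=R_{i,k}(R_{r,k}^\top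 R_{r,k})^{-1}R_{r,k}^\top Q_{r,k}$ and $V^i_k=\Lambda_k^{i\top}\Lambda^i_k-\Lambda_k^{i\top}Q_{i,k}-Q_{i,k}^\top\Lambda^i_k$, and let $\succeq$ be the Loewner order. \textbf{Stability.} A matrix $T$ with $\Sigma_k\succeq T\succeq O$ is \emph{stage-stable} for sender $i$ at stage $k$ if it minimizes $\mathrm{Tr}(V^i_kS)$ over $\Sigma_k\succeq S\succeq T$. For $j=1,\dots,n$ let $B_j$ be a map on matrices that is monotone on $\{T: O\preceq T\preceq\Sigma_{j-1}\}$ and satisfies $B_j(T)\preceq\Sigma_j$ there ($B_j(T)$ is the posterior that the other senders induce at stage $j$ when the preceding posterior is $T$). Let $\tilde V^i_{k}(T)$ be the infimum of $\sum_{j=k}^n\mathrm{Tr}(V^i_jS_j)$ over all $S_k,\dots,S_n$ which satisfy, with $S_{k-1}=T$, the constraints $\Sigma_j\succeq S_j$, $S_j\succeq AS_{j-1}A^\top$ and $S_j\succeq B_j(S_{j-1})$ for $k\le j\le n$. The matrix $T$ is \emph{stable for the full cost-to-go} of sender $i$ at stage $k$ if $\Sigma_k\succeq T\succeq O$ and $T$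 minimizes $\mathrm{Tr}(V^i_kS)+\tilde V^i_{k+1}(S)$ over $\Sigma_k\succeq S\succeq T$. \textbf{Greedy posteriors.} Fix for each stage an ordering of the senders. Matrices $S^*_1,\dots,S^*_n$ are \emph{greedy} if, with $S^*_0=O$ and $M_k=\Sigma_k-AS^*_{k-1}A^\top$, for each $k$ one has $S^*_k-AS^*_{k-1}A^\top=T_m$, where $T_0=O$ and, for $j=1,\dots,m$, with $i$ the $j$-th sender in the ordering, $T_j$ is a minimizer of $\mathrm{Tr}(V^i_kS)$ over $M_k\succeq S\succeq T_{j-1}$ which among all such minimizers has the least nuclear norm $\|M_k^{-1/2}SM_k^{-1/2}\|_*$ (with the Moore--Penrose inverse if $M_k$ is singular). \textbf{Claim.} (a) For every choice of orderings greedy $S_1^*,\dots,S_n^*$ exist. (b) For all greedy $S^*_1,\dots,S^*_n$ (with $S^*_0=O$): (i) there are orthogonal projection matrices $P_1,\dots,P_n$ such that, for $k=0,\dots,n-1$, $$S^*_{k+1}=AS^*_{k}A^\top+(\Sigma_{k+1}-AS^*_kA^\top)^{1/2}P_{k+1}(\Sigma_{k+1}-AS^*_kA^\top)^{1/2};$$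 (ii) $S^*_1,\dots,S^*_n$ are equilibrium posteriors: some multistage hierarchical Nash equilibrium has posterior covariance $S^*_k$ at every stage $k$, and in it no unilateral deviation of a sender lowers that sender's expected cost of stages $k,\dots,n$, for any $k$; (iii) each $S^*_k$ is stage-stable, and stable for the full cost-to-go, for every sender and every choice of the maps $B_j$. (c) More generally, every matrix that is stage-stable for a sender at a stage $k\in\{1,\dots,n\}$ is stable for that sender's full cost-to-go at stage $k$, for every choice of the maps $B_j$. -/

import Mathlib

open MeasureTheory ProbabilityTheory
open scoped MatrixOrder Matrix

noncomputable section

/-- Data and standing assumptions of the `n`-stage signaling game between `m` senders and one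
receiver, with state in `ℝ^p`, receiver action in `ℝ^t` and cost matrices with `q` rows.
A player is `some i` (sender `i`) or `none` (the receiver).  Stages are `1, …, n`.
The Loewner order on matrices is `X ≤ Y ↔ (Y - X).PosSemidef`. -/
structure SignalingGame (m p t q : ℕ) where
  /-- number of stages -/
  n : ℕ
  /-- state matrix -/
  A : Matrix (Fin p) (Fin p) ℝ
  /-- covariance of the initial state `x_0` -/
  cov0 : Matrix (Fin p) (Fin p) ℝ
  /-- covariance of the noise -/
  covW : Matrix (Fin p) (Fin p) ℝ
  /-- cost matrices: the stage cost of player `j` at stage `k` is `‖Q j k x_k + R j k u_k‖²` -/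
  Q : Option (Fin m) → ℕ → Matrix (Fin q) (Fin p) ℝ
  R : Option (Fin m) → ℕ → Matrix (Fin q) (Fin t) ℝ
  cov0_posSemidef : cov0.PosSemidef
  covW_posSemidef : covW.PosSemidef
  isUnit_receiver : ∀ k ∈ Finset.Icc 1 n, IsUnit ((R none k)ᵀ * R none k)

/-! ### Policies -/

/-- A policy of a sender: for each stage `k`, a Borel map from the states `(x_1, …, x_k)`
to the message `y_k`. -/
def SenderPolicy (p : ℕ) : Type :=
  ∀ k : ℕ, {f : (Fin k → EuclideanSpace ℝ (Fin p)) → EuclideanSpace ℝ (Fin p) // Measurable f}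

/-- A policy of the receiver: for each stage `k`, a Borel map from all the messages sent at
stages `1, …, k` to the action `u_k`. -/
def ReceiverPolicy (m p t : ℕ) : Type :=
  ∀ k : ℕ, {f : (Fin k → Fin m → EuclideanSpace ℝ (Fin p)) → EuclideanSpace ℝ (Fin t) //
    Measurable f}

/-- A profile of sender policies. -/
abbrev SenderProfile (m p : ℕ) : Type := Fin m → SenderPolicy p

/-- All the messages sent at stages `1, …, k` (the receiver's information at stage `k`);
the index `j : Fin k` stands for stage `j + 1`. -/
def messages {Ω : Type*} {m p : ℕ} (x : ℕ → Ω → EuclideanSpace ℝ (Fin p))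
    (η : SenderProfile m p) (k : ℕ) (ω : Ω) : Fin k → Fin m → EuclideanSpace ℝ (Fin p) :=
  fun j i => (η i (j + 1)).1 (fun l => x (l + 1) ω)

/-- The receiver's estimate `E[x_k | messages up to stage k]`. -/
def estimate {Ω : Type*} [MeasurableSpace Ω] {m p : ℕ} (μ : Measure Ω)
    (x : ℕ → Ω → EuclideanSpace ℝ (Fin p)) (η : SenderProfile m p) (k : ℕ) :
    Ω → EuclideanSpace ℝ (Fin p) :=
  μ[x k | MeasurableSpace.comap (messages x η k) inferInstance]

/-- The posterior covariance `E[x̂_k x̂_kᵀ]` induced at stage `k` by a sender profile. -/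
def posteriorCov {Ω : Type*} [MeasurableSpace Ω] {m p : ℕ} (μ : Measure Ω)
    (x : ℕ → Ω → EuclideanSpace ℝ (Fin p)) (η : SenderProfile m p) (k : ℕ) :
    Matrix (Fin p) (Fin p) ℝ :=
  Matrix.of fun a b => ∫ ω, estimate μ x η k ω a * estimate μ x η k ω b ∂μ

/-! ### Matrix preliminaries and the single-stage sequential procedure -/

/-- `M^{-1/2}` for a positive semidefinite `M` (the Moore-Penrose inverse of `M^{1/2}`, which is
its inverse when `M` is positive definite). -/
def invSqrt {p : ℕ} (M : Matrix (Fin p) (Fin p) ℝ) : Matrix (Fin p) (Fin p) ℝ :=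
  cfc (fun s : ℝ => (Real.sqrt s)⁻¹) M

/-- Nuclear norm: the sum of the singular values, i.e. the trace of `(XᵀX)^{1/2}`. -/
def nuclearNorm {p : ℕ} (X : Matrix (Fin p) (Fin p) ℝ) : ℝ :=
  (CFC.sqrt (Xᵀ * X)).trace

/-- `S` solves `min Tr(V S)` subject to `B ≤ S ≤ M`. -/
def IsSDPSolution {p : ℕ} (V B M S : Matrix (Fin p) (Fin p) ℝ) : Prop :=
  B ≤ S ∧ S ≤ M ∧ ∀ S', B ≤ S' → S' ≤ M → (V * S).trace ≤ (V * S').trace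

/-- `S` has the least normalized nuclear norm among the solutions of `min Tr(V S)`,
`B ≤ S ≤ M`. -/
def IsMinNuclearSolution {p : ℕ} (V B M S : Matrix (Fin p) (Fin p) ℝ) : Prop :=
  IsSDPSolution V B M S ∧ ∀ S', IsSDPSolution V B M S' →
    nuclearNorm (invSqrt M * S * invSqrt M) ≤ nuclearNorm (invSqrt M * S' * invSqrt M)

/-- `S` is returned by the sequential procedure for the single-stage game with prior covariance
`M` and sender matrices `V`: in the order given by `σ`, each sender in turn solves its own
problem, the posterior left by the preceding one being the lower bound. -/
def IsSequentialPosterior {m p : ℕ} (V : Fin m → Matrix (Fin p) (Fin p) ℝ)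
    (M : Matrix (Fin p) (Fin p) ℝ) (σ : Equiv.Perm (Fin m))
    (S : Matrix (Fin p) (Fin p) ℝ) : Prop :=
  ∃ T : ℕ → Matrix (Fin p) (Fin p) ℝ, T 0 = 0 ∧
    (∀ j : Fin m, IsMinNuclearSolution (V (σ j)) (T j) M (T (j + 1))) ∧ T m = S

namespace SignalingGame

variable {m p t q : ℕ} (G : SignalingGame m p t q)

/-! ### The state process -/

/-- `Σ_k`, by the Lyapunov recursion. -/
def stateCov : ℕ → Matrix (Fin p) (Fin p) ℝ
  | 0 => G.cov0
  | k + 1 => G.A * stateCov k * G.Aᵀ + G.covW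

/-- `x_0 ∼ N(0, cov0)` and `x_{k+1} = A x_k + w_k` for `k < n`, where the `w_k ∼ N(0, covW)` and
`x_0` are independent. -/
def IsGaussMarkovState {Ω : Type*} [MeasurableSpace Ω] (μ : Measure Ω)
    (x : ℕ → Ω → EuclideanSpace ℝ (Fin p)) : Prop :=
  ∃ w : ℕ → Ω → EuclideanSpace ℝ (Fin p),
    Measurable (x 0) ∧ (∀ k < G.n, Measurable (w k)) ∧
    μ.map (x 0) = multivariateGaussian 0 G.cov0 ∧
    (∀ k < G.n, μ.map (w k) = multivariateGaussian 0 G.covW) ∧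
    iIndepFun (Fin.cons (x 0) (fun j : Fin G.n => w j) :
      Fin (G.n + 1) → Ω → EuclideanSpace ℝ (Fin p)) μ ∧
    ∀ k < G.n, ∀ ω, x (k + 1) ω = Matrix.toEuclideanLin G.A (x k ω) + w k ω

/-! ### Costs and equilibrium -/

/-- Expected cost of player `j` accumulated over the stages in `s`; a nonnegative quantity,
`∞` when the stage cost is not integrable. -/
def cost {Ω : Type*} [MeasurableSpace Ω] (μ : Measure Ω)
    (x : ℕ → Ω → EuclideanSpace ℝ (Fin p)) (j : Option (Fin m)) (s : Finset ℕ)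
    (η : SenderProfile m p) (γ : ReceiverPolicy m p t) : ENNReal :=
  ∫⁻ ω, ∑ k ∈ s, ENNReal.ofReal
    (‖Matrix.toEuclideanLin (G.Q j k) (x k ω) +
      Matrix.toEuclideanLin (G.R j k) ((γ k).1 (messages x η k ω))‖ ^ 2) ∂μ

/-- Multistage hierarchical Nash equilibrium: `γ` maps every sender profile to a best response of
the receiver, and no sender gains by a unilateral deviation that the receiver responds to; both
requirements are made for the costs of stages `1, …, k`, for every `k ≤ n` (`k = n` is the whole
game). -/
def IsEquilibrium {Ω : Type*} [MeasurableSpace Ω] (μ : Measure Ω)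
    (x : ℕ → Ω → EuclideanSpace ℝ (Fin p)) (η : SenderProfile m p)
    (γ : SenderProfile m p → ReceiverPolicy m p t) : Prop :=
  (∀ k ∈ Finset.Icc 1 G.n, ∀ (η' : SenderProfile m p) (g : ReceiverPolicy m p t),
    G.cost μ x none (Finset.Icc 1 k) η' (γ η') ≤ G.cost μ x none (Finset.Icc 1 k) η' g) ∧
  (∀ k ∈ Finset.Icc 1 G.n, ∀ (i : Fin m) (e : SenderPolicy p),
    G.cost μ x (some i) (Finset.Icc 1 k) η (γ η) ≤
      G.cost μ x (some i) (Finset.Icc 1 k) (Function.update η i e) (γ (Function.update η i e)))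

/-! ### Stable posteriors -/

/-- `Λ_k^i = R_{i,k} (R_{r,k}ᵀ R_{r,k})⁻¹ R_{r,k}ᵀ Q_{r,k}`. -/
def lam (i : Fin m) (k : ℕ) : Matrix (Fin q) (Fin p) ℝ :=
  G.R (some i) k * ((G.R none k)ᵀ * G.R none k)⁻¹ * (G.R none k)ᵀ * G.Q none k

/-- `V_k^i`: up to a constant, sender `i`'s expected cost at stage `k` is `Tr(V_k^i S)` when the
receiver responds optimally with posterior covariance `S`. -/
def V (i : Fin m) (k : ℕ) : Matrix (Fin p) (Fin p) ℝ :=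
  (G.lam i k)ᵀ * G.lam i k - (G.lam i k)ᵀ * G.Q (some i) k - (G.Q (some i) k)ᵀ * G.lam i k

/-- The posterior `T` at stage `k` is stable for sender `i` with respect to the cost of stage `k`
alone: it minimizes `Tr(V_k^i S)` over `Σ_k ≥ S ≥ T`. -/
def IsStageStable (i : Fin m) (k : ℕ) (T : Matrix (Fin p) (Fin p) ℝ) : Prop :=
  0 ≤ T ∧ IsSDPSolution (G.V i k) T (G.stateCov k) T

/-- `B k T` stands for the posterior that the other senders induce at stage `k` when the posterior
at stage `k - 1` is `T`: it is at most `Σ_k` and grows with `T` (it may be constant). -/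
def IsFloor (B : ℕ → Matrix (Fin p) (Fin p) ℝ → Matrix (Fin p) (Fin p) ℝ) : Prop :=
  ∀ k ∈ Finset.Icc 1 G.n,
    (∀ T, 0 ≤ T → T ≤ G.stateCov (k - 1) → B k T ≤ G.stateCov k) ∧
    (∀ T T', 0 ≤ T → T ≤ T' → T' ≤ G.stateCov (k - 1) → B k T ≤ B k T')

/-- `S k, …, S n` are posteriors that sender `i` can aim at, at stages `k, …, n`, after the
posterior `T` at stage `k - 1`, when the others induce `B`: each is at most the state covariance,
and at least both what the receiver already infers from the preceding posterior and what the
others reveal. -/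
def IsContinuation (B : ℕ → Matrix (Fin p) (Fin p) ℝ → Matrix (Fin p) (Fin p) ℝ) (k : ℕ)
    (T : Matrix (Fin p) (Fin p) ℝ) (S : ℕ → Matrix (Fin p) (Fin p) ℝ) : Prop :=
  S (k - 1) = T ∧ ∀ j ∈ Finset.Icc k G.n,
    G.A * S (j - 1) * G.Aᵀ ≤ S j ∧ B j (S (j - 1)) ≤ S j ∧ S j ≤ G.stateCov j

/-- Value function of sender `i`: the least total cost of stages `k, …, n` after the posterior `T`
at stage `k - 1`, when the others induce `B`. -/
def value (B : ℕ → Matrix (Fin p) (Fin p) ℝ → Matrix (Fin p) (Fin p) ℝ) (i : Fin m) (k : ℕ)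
    (T : Matrix (Fin p) (Fin p) ℝ) : ℝ :=
  sInf {c | ∃ S, G.IsContinuation B k T S ∧ c = ∑ j ∈ Finset.Icc k G.n, (G.V i j * S j).trace}

/-- The posterior `T` at stage `k` is stable for sender `i` with respect to the full cost-to-go:
it minimizes `Tr(V_k^i S) + (value from stage k + 1 after S)` over `Σ_k ≥ S ≥ T`. -/
def IsCostToGoStable (B : ℕ → Matrix (Fin p) (Fin p) ℝ → Matrix (Fin p) (Fin p) ℝ) (i : Fin m)
    (k : ℕ) (T : Matrix (Fin p) (Fin p) ℝ) : Prop :=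
  0 ≤ T ∧ T ≤ G.stateCov k ∧ ∀ S, T ≤ S → S ≤ G.stateCov k →
    (G.V i k * T).trace + G.value B i (k + 1) T ≤ (G.V i k * S).trace + G.value B i (k + 1) S

/-- `S 1, …, S n` are computed greedily: `S 0 = 0`, and at each stage `k` the increment
`S k - A (S (k-1)) Aᵀ` is returned by the sequential procedure of the single-stage game with the
stage-`k` costs and prior covariance `Σ_k - A (S (k-1)) Aᵀ`, in the order `σ k`. -/
def IsGreedy (σ : ℕ → Equiv.Perm (Fin m)) (S : ℕ → Matrix (Fin p) (Fin p) ℝ) : Prop :=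
  S 0 = 0 ∧ ∀ k ∈ Finset.Icc 1 G.n,
    IsSequentialPosterior (fun i => G.V i k) (G.stateCov k - G.A * S (k - 1) * G.Aᵀ) (σ k)
      (S k - G.A * S (k - 1) * G.Aᵀ)

end SignalingGame

end

/-!
Conjugation by `M^{-1/2}` turns the feasible set of the trace minimization into an order interval
of contractions.  If its lower end is a projection and `Y` in it is optimal, then `Y²` and
`2Y - Y²` are feasible with midpoint `Y`, hence optimal as well; since `Tr Y² ≤ Tr Y`, the optimal
`Y` of least nuclear norm satisfies `Y² = Y`.  So the greedy posteriors come from projections, and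
each is stage-stable because the later senders only raise the posterior of a sender who has
optimized.  A continuation of a larger posterior is also a continuation of a smaller one, so the
future value is monotone in the posterior and stage-stability gives stability for the cost-to-go.

For the equilibrium all senders report the same linear filter of the states, whose gain
`D M⁺` turns an innovation of covariance `M` into a correction of covariance `D`.  Its error is
uncorrelated with the messages, hence independent of them since everything is jointly Gaussian, and
the estimate of the receiver is the filter itself.  The best response to any profile is certainty
equivalent, so the cost of a sender is affine in the posterior covariance.  A deviating sender
leaves the messages of the others in place and can only increase the posterior, which
stage-stability makes unprofitable.
-/

/-! ### The Loewner order -/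

section Loewner

variable {n κ : Type*} {B M P X Y E : Matrix n n ℝ}

lemma transpose_eq_of_nonneg (h : 0 ≤ X) : Xᵀ = X :=
  (Matrix.nonneg_iff_posSemidef.1 h).isHermitian

lemma isClosed_setOf_posSemidef [Finite n] : IsClosed {X : Matrix n n ℝ | X.PosSemidef} := by
  have := Fintype.ofFinite n
  simp only [Matrix.posSemidef_iff_dotProduct_mulVec, Set.ofPred_and, Set.ofPred_forall]
  exact (isClosed_eq (by fun_prop) (by fun_prop)).inter
    (isClosed_iInter fun v => isClosed_le continuous_const (by fun_prop))

lemma two_mul_abs_apply_le [Finite n] (h : 0 ≤ X) (a b : n) : 2 * |X a b| ≤ X a a + X b b := by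
  classical
  have := Fintype.ofFinite n
  have hsymm : X b a = X a b := congrFun (congrFun (transpose_eq_of_nonneg h) a) b
  have quad : ∀ s : ℝ, 0 ≤ X a a + s * (X a b + X b a) + s * s * X b b := by
    intro s
    have := (Matrix.nonneg_iff_posSemidef.1 h).dotProduct_mulVec_nonneg
      (Pi.single a 1 + s • Pi.single b 1)
    simp only [star_trivial, Matrix.mulVec_add, Matrix.mulVec_smul, Matrix.mulVec_single_one,
      dotProduct_add, add_dotProduct, smul_dotProduct, dotProduct_smul, single_one_dotProduct,
      Matrix.col_apply, smul_eq_mul] at this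
    linarith
  have hadd := quad 1
  have hsub := quad (-1)
  cases abs_cases (X a b) <;> linarith

lemma isCompact_Icc_loewner [Finite n] (hB : 0 ≤ B) : IsCompact (Set.Icc B M) := by
  have hbox : IsCompact (Set.univ.pi fun a => Set.univ.pi fun b =>
      Set.Icc (-((M a a + M b b) / 2)) ((M a a + M b b) / 2)) :=
    isCompact_univ_pi fun _ => isCompact_univ_pi fun _ => isCompact_Icc
  have hclosed : IsClosed (Set.Icc B M) :=
    (isClosed_setOf_posSemidef.preimage (continuous_id.sub continuous_const)).inter
      (isClosed_setOf_posSemidef.preimage (continuous_const.sub continuous_id))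
  refine hbox.of_isClosed_subset hclosed fun X hX a _ b _ => abs_le.1 ?_
  have hdiag : ∀ c, X c c ≤ M c c := fun c => sub_nonneg.1 (Matrix.le_iff.1 hX.2).diag_nonneg
  linarith [two_mul_abs_apply_le (hB.trans hX.1) a b, hdiag a, hdiag b]

variable [Fintype n]

lemma mul_mul_transpose_nonneg (h : 0 ≤ X) (C : Matrix n n ℝ) : 0 ≤ C * X * Cᵀ :=
  star_right_conjugate_nonneg h C

lemma mul_mul_transpose_mono (h : X ≤ Y) (C : Matrix n n ℝ) : C * X * Cᵀ ≤ C * Y * Cᵀ :=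
  star_right_conjugate_le_conjugate h C

lemma trace_mono (h : X ≤ Y) : X.trace ≤ Y.trace :=
  OrderHomClass.mono (Matrix.tracePositiveLinearMap n ℝ ℝ) h

lemma eq_of_le_of_trace_le (h : X ≤ Y) (htr : Y.trace ≤ X.trace) : X = Y := by
  have h0 : (Y - X).trace = 0 := by
    rw [Matrix.trace_sub, sub_eq_zero]
    exact htr.antisymm (trace_mono h)
  exact (sub_eq_zero.1 ((Matrix.le_iff.1 h).trace_eq_zero_iff.1 h0)).symm

lemma mul_eq_zero_of_nonneg_of_le {C : Matrix n κ ℝ} (h0 : 0 ≤ X) (h : X ≤ Y) (hC : Y * C = 0) :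
    X * C = 0 := by
  have hX := Matrix.nonneg_iff_posSemidef.1 h0
  ext a b
  have hYb : Y *ᵥ C.col b = 0 := by
    ext a
    exact congrFun (congrFun hC a) b
  have hle := (Matrix.le_iff.1 h).dotProduct_mulVec_nonneg (C.col b)
  rw [Matrix.sub_mulVec, hYb, zero_sub, dotProduct_neg, neg_nonneg] at hle
  have hXb := (hX.dotProduct_mulVec_zero_iff _).1 (hle.antisymm (hX.dotProduct_mulVec_nonneg _))
  exact congrFun hXb a

lemma mul_self_le_self [DecidableEq n] (h0 : 0 ≤ Y) (h1 : Y ≤ 1) : Y * Y ≤ Y := by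
  have hs : IsSelfAdjoint Y := .of_nonneg h0
  have hY := hs.conjugate_nonneg (sub_nonneg.2 h1)
  have hY' := ((IsSelfAdjoint.one _).sub hs).conjugate_nonneg h0
  rw [← sub_nonneg]
  convert add_nonneg hY hY' using 1
  noncomm_ring

lemma projection_le_mul_self [DecidableEq n] (hP : IsStarProjection P) (h : P ≤ Y) (h1 : Y ≤ 1) :
    P ≤ Y * Y := by
  have hs : IsSelfAdjoint Y := .of_nonneg (hP.nonneg.trans h)
  have hYP : Y * P = P := by
    have := mul_eq_zero_of_nonneg_of_le (sub_nonneg.2 h1) (sub_le_sub_left h 1) hP.one_sub_mul_self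
    rwa [sub_mul, one_mul, sub_eq_zero, eq_comm] at this
  have hPY : P * Y = P := by
    simpa [hs.star_eq, hP.isSelfAdjoint.star_eq] using congrArg star hYP
  have hsq := (hs.sub hP.isSelfAdjoint).mul_self_nonneg
  rw [← sub_nonneg]
  convert hsq using 1
  rw [mul_sub, sub_mul, sub_mul, hYP, hPY, hP.isIdempotentElem.eq, sub_self, sub_zero]

lemma add_sub_mul_self_le_projection (hE : IsStarProjection E) (h0 : 0 ≤ Y) (h : Y ≤ E) :
    Y + (Y - Y * Y) ≤ E := by
  classical
  have := projection_le_mul_self hE.one_sub (sub_le_sub_left h 1) (sub_le_self 1 h0)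
  rw [← sub_nonneg] at this ⊢
  convert this using 1
  noncomm_ring

end Loewner

/-! ### Square roots and the solution of least nuclear norm -/

section SquareRoot

variable {p : ℕ}

/-- The orthogonal projection onto the range of the positive semidefinite matrix `M`, written as
`M^{-1/2} M^{1/2}`. -/
noncomputable def supportProj (M : Matrix (Fin p) (Fin p) ℝ) : Matrix (Fin p) (Fin p) ℝ :=
  invSqrt M * CFC.sqrt M

/-- The matrix `M^{-1/2} X M^{-1/2}`, whose nuclear norm selects among the minimizers; it turns the
order interval `[0, M]` into `[0, supportProj M]`. -/
noncomputable def whiten (M X : Matrix (Fin p) (Fin p) ℝ) : Matrix (Fin p) (Fin p) ℝ :=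
  invSqrt M * X * invSqrt M

variable {B M S V X Y : Matrix (Fin p) (Fin p) ℝ}

lemma isSelfAdjoint_sqrt (M : Matrix (Fin p) (Fin p) ℝ) : IsSelfAdjoint (CFC.sqrt M) :=
  .of_nonneg (CFC.sqrt_nonneg M)

lemma isSelfAdjoint_invSqrt (M : Matrix (Fin p) (Fin p) ℝ) : IsSelfAdjoint (invSqrt M) :=
  cfc_predicate _ M

lemma cfc_mul_cfc (f g : ℝ → ℝ) (M : Matrix (Fin p) (Fin p) ℝ) :
    cfc f M * cfc g M = cfc (fun s => f s * g s) M :=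
  (cfc_mul f g M (M.finite_real_spectrum.continuousOn f)
    (M.finite_real_spectrum.continuousOn g)).symm

lemma sqrt_eq_cfc_real (hM : 0 ≤ M) : CFC.sqrt M = cfc Real.sqrt M := by
  rw [CFC.sqrt_eq_real_sqrt M hM, cfcₙ_eq_cfc]

lemma sqrt_mul_invSqrt (hM : 0 ≤ M) : CFC.sqrt M * invSqrt M = supportProj M := by
  rw [supportProj, sqrt_eq_cfc_real hM]
  exact cfc_commute_cfc _ _ M

lemma supportProj_mul_sqrt (hM : 0 ≤ M) : supportProj M * CFC.sqrt M = CFC.sqrt M := by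
  rw [← sqrt_mul_invSqrt hM, sqrt_eq_cfc_real hM, invSqrt, cfc_mul_cfc, cfc_mul_cfc]
  simp only [mul_inv_mul_cancel]

lemma supportProj_mul_invSqrt (hM : 0 ≤ M) : supportProj M * invSqrt M = invSqrt M := by
  rw [supportProj, sqrt_eq_cfc_real hM, invSqrt, cfc_mul_cfc, cfc_mul_cfc]
  simpa using congrArg (cfc · M) (funext fun s => mul_inv_mul_cancel (Real.sqrt s)⁻¹)

lemma isStarProjection_supportProj (hM : 0 ≤ M) : IsStarProjection (supportProj M) where
  isIdempotentElem := by
    rw [IsIdempotentElem]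
    nth_rw 2 [supportProj]
    rw [← mul_assoc, supportProj_mul_invSqrt hM, supportProj]
  isSelfAdjoint := by
    rw [isSelfAdjoint_iff, supportProj, star_mul, (isSelfAdjoint_sqrt M).star_eq,
      (isSelfAdjoint_invSqrt M).star_eq, sqrt_mul_invSqrt hM, supportProj]

lemma invSqrt_mul_supportProj (hM : 0 ≤ M) : invSqrt M * supportProj M = invSqrt M := by
  simpa [(isSelfAdjoint_invSqrt M).star_eq, (isStarProjection_supportProj hM).isSelfAdjoint.star_eq]
    using congrArg star (supportProj_mul_invSqrt hM)

lemma mul_supportProj (hS0 : 0 ≤ S) (hSM : S ≤ M) : S * supportProj M = S := by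
  have hM := hS0.trans hSM
  have hME : M * supportProj M = M := by
    calc M * supportProj M = CFC.sqrt M * (CFC.sqrt M * invSqrt M * CFC.sqrt M) := by
          nth_rw 1 [← CFC.sqrt_mul_sqrt_self M hM]
          simp only [supportProj, mul_assoc]
      _ = M := by
          rw [sqrt_mul_invSqrt hM, supportProj_mul_sqrt hM, CFC.sqrt_mul_sqrt_self M hM]
  have hker : M * (1 - supportProj M) = 0 := by rw [mul_sub, mul_one, hME, sub_self]
  have := mul_eq_zero_of_nonneg_of_le hS0 hSM hker
  rwa [mul_sub, mul_one, sub_eq_zero, eq_comm] at this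

lemma supportProj_mul (hS0 : 0 ≤ S) (hSM : S ≤ M) : supportProj M * S = S := by
  have hE := isStarProjection_supportProj (hS0.trans hSM)
  simpa [(IsSelfAdjoint.of_nonneg hS0).star_eq, hE.isSelfAdjoint.star_eq]
    using congrArg star (mul_supportProj hS0 hSM)

lemma whiten_mono (h : X ≤ Y) : whiten M X ≤ whiten M Y :=
  (isSelfAdjoint_invSqrt M).conjugate_le_conjugate h

lemma whiten_nonneg (h : 0 ≤ X) : 0 ≤ whiten M X :=
  (isSelfAdjoint_invSqrt M).conjugate_nonneg h

lemma whiten_self (hM : 0 ≤ M) : whiten M M = supportProj M := by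
  have : invSqrt M * M = CFC.sqrt M := by
    rw [← supportProj_mul_sqrt hM, supportProj, mul_assoc, CFC.sqrt_mul_sqrt_self M hM]
  rw [whiten, this, sqrt_mul_invSqrt hM]

lemma sqrt_conj_whiten (hS0 : 0 ≤ S) (hSM : S ≤ M) :
    CFC.sqrt M * whiten M S * CFC.sqrt M = S := by
  calc CFC.sqrt M * (invSqrt M * S * invSqrt M) * CFC.sqrt M
      = CFC.sqrt M * invSqrt M * S * (invSqrt M * CFC.sqrt M) := by simp only [mul_assoc]
    _ = S := by
      rw [sqrt_mul_invSqrt (hS0.trans hSM), supportProj_mul hS0 hSM, ← supportProj,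
        mul_supportProj hS0 hSM]

lemma whiten_sqrt_conj (hM : 0 ≤ M) (h0 : 0 ≤ Y) (h : Y ≤ supportProj M) :
    whiten M (CFC.sqrt M * Y * CFC.sqrt M) = Y := by
  have hE := isStarProjection_supportProj hM
  have hYE : Y * supportProj M = Y := by
    have := mul_eq_zero_of_nonneg_of_le h0 h hE.mul_one_sub_self
    rwa [mul_sub, mul_one, sub_eq_zero, eq_comm] at this
  have hEY : supportProj M * Y = Y := by
    simpa [(IsSelfAdjoint.of_nonneg h0).star_eq, hE.isSelfAdjoint.star_eq] using congrArg star hYE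
  calc invSqrt M * (CFC.sqrt M * Y * CFC.sqrt M) * invSqrt M
      = invSqrt M * CFC.sqrt M * Y * (CFC.sqrt M * invSqrt M) := by simp only [mul_assoc]
    _ = Y := by rw [← supportProj, hEY, sqrt_mul_invSqrt hM, hYE]

lemma sqrt_conj_mem_Icc (hB : 0 ≤ B) (hBM : B ≤ M) (h : Y ∈ Set.Icc (whiten M B) (supportProj M)) :
    CFC.sqrt M * Y * CFC.sqrt M ∈ Set.Icc B M := by
  have hM := hB.trans hBM
  constructor
  · simpa only [sqrt_conj_whiten hB hBM] using (isSelfAdjoint_sqrt M).conjugate_le_conjugate h.1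
  · simpa only [← whiten_self hM, sqrt_conj_whiten hM le_rfl]
      using (isSelfAdjoint_sqrt M).conjugate_le_conjugate h.2

lemma nuclearNorm_of_nonneg (h : 0 ≤ X) : nuclearNorm X = X.trace := by
  rw [nuclearNorm, transpose_eq_of_nonneg h, CFC.sqrt_mul_self X h]

-- With `Y = whiten M S`, the matrix `S` is the midpoint of the feasible matrices
-- `M^{1/2} Y² M^{1/2}` and `M^{1/2} (2Y - Y²) M^{1/2}`, so both are optimal.
lemma IsSDPSolution.sqrt_conj_mul_self (hB : 0 ≤ B) (hP : IsStarProjection (whiten M B))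
    (h : IsSDPSolution V B M S) :
    IsSDPSolution V B M (CFC.sqrt M * (whiten M S * whiten M S) * CFC.sqrt M) := by
  obtain ⟨hBS, hSM, hopt⟩ := h
  have hS := hB.trans hBS
  have hE := isStarProjection_supportProj (hS.trans hSM)
  set H := CFC.sqrt M
  set Y := whiten M S
  have hY0 : 0 ≤ Y := whiten_nonneg hS
  have hPY : whiten M B ≤ Y := whiten_mono hBS
  have hYE : Y ≤ supportProj M := whiten_self (hS.trans hSM) ▸ whiten_mono hSM
  have hYY := mul_self_le_self hY0 (hYE.trans hE.le_one)
  have hlow : H * (Y * Y) * H ∈ Set.Icc B M := sqrt_conj_mem_Icc hB (hBS.trans hSM)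
    ⟨projection_le_mul_self hP hPY (hYE.trans hE.le_one), hYY.trans hYE⟩
  have hhigh : H * (Y + (Y - Y * Y)) * H ∈ Set.Icc B M := sqrt_conj_mem_Icc hB (hBS.trans hSM)
    ⟨hPY.trans (le_add_of_nonneg_right (sub_nonneg.2 hYY)),
      add_sub_mul_self_le_projection hE hY0 hYE⟩
  have hmid : H * (Y + (Y - Y * Y)) * H + H * (Y * Y) * H = S + S := by
    calc _ = H * Y * H + H * Y * H := by noncomm_ring
      _ = S + S := by rw [sqrt_conj_whiten hS hSM]
  have hcost : (V * (H * (Y + (Y - Y * Y)) * H)).trace + (V * (H * (Y * Y) * H)).trace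
      = (V * S).trace + (V * S).trace := by
    rw [← Matrix.trace_add, ← mul_add, hmid, mul_add, Matrix.trace_add]
  exact ⟨hlow.1, hlow.2, fun S' hBS' hSM' => by
    linarith [hopt _ hhigh.1 hhigh.2, hopt S' hBS' hSM']⟩

lemma IsMinNuclearSolution.isStarProjection_whiten (hB : 0 ≤ B)
    (hP : IsStarProjection (whiten M B)) (h : IsMinNuclearSolution V B M S) :
    IsStarProjection (whiten M S) := by
  have hS := hB.trans h.1.1
  have hM := hS.trans h.1.2.1
  have hE := isStarProjection_supportProj hM
  have hY0 : 0 ≤ whiten M S := whiten_nonneg hS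
  have hYE : whiten M S ≤ supportProj M := whiten_self hM ▸ whiten_mono h.1.2.1
  have hYY := mul_self_le_self hY0 (hYE.trans hE.le_one)
  have hYY0 := (IsSelfAdjoint.of_nonneg hY0).mul_self_nonneg
  have hnorm : nuclearNorm (whiten M S) ≤
      nuclearNorm (whiten M (CFC.sqrt M * (whiten M S * whiten M S) * CFC.sqrt M)) :=
    h.2 _ (h.1.sqrt_conj_mul_self hB hP)
  rw [whiten_sqrt_conj hM hYY0 (hYY.trans hYE), nuclearNorm_of_nonneg hY0,
    nuclearNorm_of_nonneg hYY0] at hnorm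
  exact ⟨eq_of_le_of_trace_le hYY hnorm, .of_nonneg hY0⟩

lemma exists_isMinNuclearSolution (V : Matrix (Fin p) (Fin p) ℝ) (hB : 0 ≤ B) (hBM : B ≤ M) :
    ∃ S, IsMinNuclearSolution V B M S := by
  have hIcc := isCompact_Icc_loewner (M := M) hB
  obtain ⟨S₀, hS₀, hopt⟩ := hIcc.exists_isMinOn ⟨B, le_rfl, hBM⟩
    (f := fun S => (V * S).trace) (by fun_prop)
  have hargmin : IsCompact (Set.Icc B M ∩ {S | (V * S).trace ≤ (V * S₀).trace}) :=
    hIcc.inter_right (isClosed_le (by fun_prop) continuous_const)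
  obtain ⟨S, hS, hmin⟩ := hargmin.exists_isMinOn ⟨S₀, hS₀, le_refl (V * S₀).trace⟩
    (f := fun S => (whiten M S).trace) (by unfold whiten; fun_prop)
  refine ⟨S, ⟨hS.1.1, hS.1.2, fun S' hBS' hSM' => hS.2.trans (hopt ⟨hBS', hSM'⟩)⟩, fun S' hS' => ?_⟩
  change nuclearNorm (whiten M S) ≤ nuclearNorm (whiten M S')
  rw [nuclearNorm_of_nonneg (whiten_nonneg (hB.trans hS.1.1)),
    nuclearNorm_of_nonneg (whiten_nonneg (hB.trans hS'.1))]
  exact hmin ⟨⟨hS'.1, hS'.2.1⟩, hS'.2.2 S₀ hS₀.1 hS₀.2⟩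

end SquareRoot

/-! ### The sequential procedure -/

section SequentialProcedure

variable {m p : ℕ} {B M S X : Matrix (Fin p) (Fin p) ℝ}

lemma IsSDPSolution.trace_mul_nonneg {V : Matrix (Fin p) (Fin p) ℝ} (h : IsSDPSolution V B M S)
    (hX : 0 ≤ X) (hXM : X ≤ M - S) : 0 ≤ (V * X).trace := by
  have := h.2.2 (S + X) (h.1.trans (le_add_of_nonneg_right hX))
    (add_comm S X ▸ le_sub_iff_add_le.1 hXM)
  rw [mul_add, Matrix.trace_add] at this
  linarith

lemma exists_isSequentialPosterior (V : Fin m → Matrix (Fin p) (Fin p) ℝ) (hM : 0 ≤ M)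
    (σ : Equiv.Perm (Fin m)) : ∃ S, IsSequentialPosterior V M σ S := by
  have step : ∀ (j : ℕ) (T : Set.Icc 0 M), ∃ T' : Set.Icc 0 M,
      ∀ h : j < m, IsMinNuclearSolution (V (σ ⟨j, h⟩)) T.1 M T'.1 := by
    intro j T
    by_cases h : j < m
    · obtain ⟨S, hS⟩ := exists_isMinNuclearSolution (V (σ ⟨j, h⟩)) T.2.1 T.2.2
      exact ⟨⟨S, T.2.1.trans hS.1.1, hS.1.2.1⟩, fun _ => hS⟩
    · exact ⟨T, fun h' => absurd h' h⟩
  choose next hnext using step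
  let T : ℕ → Set.Icc 0 M := fun j => Nat.rec ⟨0, le_rfl, hM⟩ next j
  exact ⟨(T m).1, fun j => (T j).1, rfl, fun j => hnext j (T j) j.2, rfl⟩

variable {V : Fin m → Matrix (Fin p) (Fin p) ℝ} {σ : Equiv.Perm (Fin m)}
  {T : ℕ → Matrix (Fin p) (Fin p) ℝ}

lemma monotoneOn_of_isMinNuclearSolution
    (hT : ∀ j : Fin m, IsMinNuclearSolution (V (σ j)) (T j) M (T (j + 1))) :
    MonotoneOn T (Set.Iic m) :=
  monotoneOn_of_le_succ Set.ordConnected_Iic fun j _ _ hj => (hT ⟨j, hj⟩).1.1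

lemma IsSequentialPosterior.nonneg (h : IsSequentialPosterior V M σ S) : 0 ≤ S := by
  obtain ⟨T, hT0, hT, rfl⟩ := h
  exact hT0 ▸ monotoneOn_of_isMinNuclearSolution hT (Nat.zero_le m) Set.self_mem_Iic (Nat.zero_le m)

lemma IsSequentialPosterior.le (hM : 0 ≤ M) (h : IsSequentialPosterior V M σ S) : S ≤ M := by
  obtain ⟨T, hT0, hT, rfl⟩ := h
  cases m with
  | zero => exact hT0 ▸ hM
  | succ m => exact (hT (Fin.last m)).1.2.1

lemma IsSequentialPosterior.isStarProjection_whiten (h : IsSequentialPosterior V M σ S) :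
    IsStarProjection (whiten M S) := by
  obtain ⟨T, hT0, hT, rfl⟩ := h
  have hmono := monotoneOn_of_isMinNuclearSolution hT
  suffices ∀ j ≤ m, IsStarProjection (whiten M (T j)) from this m le_rfl
  intro j
  induction j with
  | zero => simp [hT0, whiten, IsStarProjection.zero]
  | succ j ih =>
    intro hj
    have hj0 : 0 ≤ T j := hT0 ▸ hmono (Nat.zero_le m) (Nat.le_of_succ_le hj) (Nat.zero_le j)
    exact (hT ⟨j, hj⟩).isStarProjection_whiten hj0 (ih (Nat.le_of_succ_le hj))

lemma IsSequentialPosterior.trace_mul_nonneg (h : IsSequentialPosterior V M σ S) (i : Fin m)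
    (hX : 0 ≤ X) (hXM : X ≤ M - S) : 0 ≤ (V i * X).trace := by
  obtain ⟨T, _, hT, rfl⟩ := h
  have hlast : T (σ.symm i + 1) ≤ T m :=
    monotoneOn_of_isMinNuclearSolution hT (σ.symm i).2 Set.self_mem_Iic (σ.symm i).2
  simpa using (hT (σ.symm i)).1.trace_mul_nonneg hX (hXM.trans (sub_le_sub_left hlast M))

end SequentialProcedure

/-! ### Cost-to-go and greedy posteriors -/

namespace SignalingGame

section CostToGo

variable {m p t q : ℕ} (G : SignalingGame m p t q)

/-- The covariance of what the receiver cannot predict about the state of stage `k` when the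
posterior covariance of the preceding stage is `T`. -/
noncomputable def priorCov (k : ℕ) (T : Matrix (Fin p) (Fin p) ℝ) : Matrix (Fin p) (Fin p) ℝ :=
  G.stateCov k - G.A * T * G.Aᵀ

lemma stateCov_nonneg (k : ℕ) : 0 ≤ G.stateCov k := by
  induction k with
  | zero => exact Matrix.nonneg_iff_posSemidef.2 G.cov0_posSemidef
  | succ k ih =>
    exact add_nonneg (mul_mul_transpose_nonneg ih _)
      (Matrix.nonneg_iff_posSemidef.2 G.covW_posSemidef)

variable {G} {B : ℕ → Matrix (Fin p) (Fin p) ℝ → Matrix (Fin p) (Fin p) ℝ}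
  {T T' : Matrix (Fin p) (Fin p) ℝ} {S : ℕ → Matrix (Fin p) (Fin p) ℝ} {i : Fin m} {k : ℕ}

lemma conj_le_stateCov_succ (h : T ≤ G.stateCov k) : G.A * T * G.Aᵀ ≤ G.stateCov (k + 1) :=
  (mul_mul_transpose_mono h _).trans
    (le_add_of_nonneg_right (Matrix.nonneg_iff_posSemidef.2 G.covW_posSemidef))

lemma priorCov_succ_nonneg (h : T ≤ G.stateCov k) : 0 ≤ G.priorCov (k + 1) T :=
  sub_nonneg.2 (conj_le_stateCov_succ h)

lemma IsContinuation.nonneg (h : G.IsContinuation B (k + 1) T S) (hT : 0 ≤ T) {j : ℕ}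
    (hkj : k ≤ j) (hj : j ≤ G.n) : 0 ≤ S j := by
  induction j, hkj using Nat.le_induction with
  | base => exact h.1 ▸ hT
  | succ j hkj ih =>
    exact (mul_mul_transpose_nonneg (ih (Nat.le_of_succ_le hj)) _).trans
      (h.2 (j + 1) (Finset.mem_Icc.2 ⟨Nat.succ_le_succ hkj, hj⟩)).1

lemma bddBelow_continuation_cost (i : Fin m) (hT : 0 ≤ T) :
    BddBelow {c | ∃ S, G.IsContinuation B (k + 1) T S ∧
      c = ∑ j ∈ Finset.Icc (k + 1) G.n, (G.V i j * S j).trace} := by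
  have hbdd (j : ℕ) : BddBelow ((fun S => (G.V i j * S).trace) '' Set.Icc 0 (G.stateCov j)) :=
    (isCompact_Icc_loewner le_rfl).bddBelow_image (by fun_prop)
  choose c hc using hbdd
  refine ⟨∑ j ∈ Finset.Icc (k + 1) G.n, c j, ?_⟩
  rintro _ ⟨S, hS, rfl⟩
  refine Finset.sum_le_sum fun j hj => hc j ⟨S j, ⟨?_, (hS.2 j hj).2.2⟩, rfl⟩
  have := Finset.mem_Icc.1 hj
  exact hS.nonneg hT (by omega) this.2

lemma IsFloor.exists_isContinuation (hB : G.IsFloor B) (hT0 : 0 ≤ T) (hT : T ≤ G.stateCov k) :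
    ∃ S, G.IsContinuation B (k + 1) T S := by
  have hbounds (j : ℕ) : Function.update G.stateCov k T j ∈ Set.Icc 0 (G.stateCov j) := by
    rcases eq_or_ne j k with rfl | hjk
    · simpa using ⟨hT0, hT⟩
    · simpa [hjk] using G.stateCov_nonneg j
  refine ⟨Function.update G.stateCov k T, by simp, fun j hj => ?_⟩
  obtain ⟨hkj, hjn⟩ := Finset.mem_Icc.1 hj
  obtain ⟨j, rfl⟩ := Nat.exists_eq_add_of_le' (Nat.one_le_of_lt hkj)
  rw [Function.update_of_ne (by omega : j + 1 ≠ k), Nat.add_sub_cancel]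
  exact ⟨conj_le_stateCov_succ (hbounds j).2,
    (hB (j + 1) (Finset.mem_Icc.2 ⟨by omega, hjn⟩)).1 _ (hbounds j).1 (hbounds j).2, le_rfl⟩

lemma IsContinuation.of_le (hB : G.IsFloor B) (hT : 0 ≤ T) (hTT' : T ≤ T')
    (hT' : T' ≤ G.stateCov k) (h : G.IsContinuation B (k + 1) T' S) :
    G.IsContinuation B (k + 1) T (Function.update S k T) := by
  refine ⟨by simp, fun j hj => ?_⟩
  obtain ⟨hkj, hjn⟩ := Finset.mem_Icc.1 hj
  obtain ⟨hstate, hfloor, hle⟩ := h.2 j hj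
  rw [Function.update_of_ne (by omega : j ≠ k)]
  rcases eq_or_ne (j - 1) k with rfl | hjk
  · rw [show S (j - 1) = T' from h.1] at hstate hfloor
    rw [Function.update_self]
    exact ⟨(mul_mul_transpose_mono hTT' _).trans hstate,
      ((hB j (Finset.mem_Icc.2 ⟨by omega, hjn⟩)).2 _ _ hT hTT' hT').trans hfloor, hle⟩
  · rw [Function.update_of_ne hjk]
    exact ⟨hstate, hfloor, hle⟩

lemma value_mono (hB : G.IsFloor B) (hT : 0 ≤ T) (hTT' : T ≤ T') (hT' : T' ≤ G.stateCov k) :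
    G.value B i (k + 1) T ≤ G.value B i (k + 1) T' := by
  obtain ⟨S₀, hS₀⟩ := hB.exists_isContinuation (hT.trans hTT') hT'
  refine csInf_le_csInf (bddBelow_continuation_cost i hT) ⟨_, S₀, hS₀, rfl⟩ ?_
  rintro _ ⟨S, hS, rfl⟩
  refine ⟨_, hS.of_le hB hT hTT' hT', Finset.sum_congr rfl fun j hj => ?_⟩
  rw [Function.update_of_ne (by have := Finset.mem_Icc.1 hj; omega : j ≠ k)]

lemma IsStageStable.isCostToGoStable (h : G.IsStageStable i k T) (hB : G.IsFloor B) :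
    G.IsCostToGoStable B i k T :=
  ⟨h.1, h.2.2.1, fun _ hTS hS => add_le_add (h.2.2.2 _ hTS hS) (value_mono hB h.1 hTS hS)⟩

end CostToGo

section Greedy

variable {m p t q : ℕ} {G : SignalingGame m p t q} {σ : ℕ → Equiv.Perm (Fin m)}
  {S : ℕ → Matrix (Fin p) (Fin p) ℝ} {k : ℕ}

lemma exists_isGreedy (G : SignalingGame m p t q) (σ : ℕ → Equiv.Perm (Fin m)) :
    ∃ S, G.IsGreedy σ S := by
  have step : ∀ (k : ℕ) (T : Set.Iic (G.stateCov k)), ∃ T' : Set.Iic (G.stateCov (k + 1)),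
      IsSequentialPosterior (fun i => G.V i (k + 1)) (G.priorCov (k + 1) T) (σ (k + 1))
        (T'.1 - G.A * T.1 * G.Aᵀ) := by
    intro k T
    have hM := priorCov_succ_nonneg T.2
    obtain ⟨S, hS⟩ := exists_isSequentialPosterior (fun i => G.V i (k + 1)) hM (σ (k + 1))
    exact ⟨⟨S + G.A * T.1 * G.Aᵀ, le_sub_iff_add_le.1 (hS.le hM)⟩, by simpa using hS⟩
  choose next hnext using step
  let S : (k : ℕ) → Set.Iic (G.stateCov k) := fun k => Nat.rec ⟨0, G.stateCov_nonneg 0⟩ next k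
  refine ⟨fun k => (S k).1, rfl, fun k hk => ?_⟩
  obtain ⟨k, rfl⟩ := Nat.exists_eq_add_of_le' (Finset.mem_Icc.1 hk).1
  exact hnext k (S k)

lemma IsGreedy.isSequentialPosterior (h : G.IsGreedy σ S) (hk : k ∈ Finset.Icc 1 G.n) :
    IsSequentialPosterior (fun i => G.V i k) (G.priorCov k (S (k - 1))) (σ k)
      (S k - G.A * S (k - 1) * G.Aᵀ) :=
  h.2 k hk

lemma IsGreedy.mem_Icc (h : G.IsGreedy σ S) (hk : k ≤ G.n) : S k ∈ Set.Icc 0 (G.stateCov k) := by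
  induction k with
  | zero => exact h.1.symm ▸ ⟨le_rfl, G.stateCov_nonneg 0⟩
  | succ k ih =>
    obtain ⟨h0, hle⟩ := ih (Nat.le_of_succ_le hk)
    have hs := h.isSequentialPosterior (Finset.mem_Icc.2 ⟨k.succ_pos, hk⟩)
    exact ⟨(mul_mul_transpose_nonneg h0 _).trans (sub_nonneg.1 hs.nonneg),
      sub_le_sub_iff_right _ |>.1 (hs.le (priorCov_succ_nonneg hle))⟩

lemma IsGreedy.priorCov_nonneg (h : G.IsGreedy σ S) (hk : k ∈ Finset.Icc 1 G.n) :
    0 ≤ G.priorCov k (S (k - 1)) := by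
  obtain ⟨k, rfl⟩ := Nat.exists_eq_add_of_le' (Finset.mem_Icc.1 hk).1
  exact priorCov_succ_nonneg (h.mem_Icc (Nat.le_of_succ_le (Finset.mem_Icc.1 hk).2)).2

lemma IsGreedy.isStageStable (h : G.IsGreedy σ S) (hk : k ∈ Finset.Icc 1 G.n) (i : Fin m) :
    G.IsStageStable i k (S k) := by
  obtain ⟨h0, hle⟩ := h.mem_Icc (Finset.mem_Icc.1 hk).2
  refine ⟨h0, le_rfl, hle, fun S' hS hS' => ?_⟩
  have := (h.isSequentialPosterior hk).trace_mul_nonneg i (sub_nonneg.2 hS)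
    (by simpa [priorCov] using hS')
  rw [mul_sub, Matrix.trace_sub] at this
  linarith

/-- The projection of the posterior formula at stage `k`: the whitened increment of the
posteriors. -/
noncomputable def stageProj (G : SignalingGame m p t q) (S : ℕ → Matrix (Fin p) (Fin p) ℝ)
    (k : ℕ) : Matrix (Fin p) (Fin p) ℝ :=
  whiten (G.priorCov k (S (k - 1))) (S k - G.A * S (k - 1) * G.Aᵀ)

lemma IsGreedy.isStarProjection_stageProj (h : G.IsGreedy σ S) (hk : k ∈ Finset.Icc 1 G.n) :
    IsStarProjection (G.stageProj S k) :=
  (h.isSequentialPosterior hk).isStarProjection_whiten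

lemma IsGreedy.eq_add_sqrt_conj (h : G.IsGreedy σ S) (hk : k ∈ Finset.Icc 1 G.n) :
    S k = G.A * S (k - 1) * G.Aᵀ + CFC.sqrt (G.priorCov k (S (k - 1))) *
      G.stageProj S k * CFC.sqrt (G.priorCov k (S (k - 1))) := by
  have hs := h.isSequentialPosterior hk
  rw [stageProj, sqrt_conj_whiten hs.nonneg (hs.le (h.priorCov_nonneg hk)), add_sub_cancel]

end Greedy

end SignalingGame

/-! ### Second moments -/

section ToEuclideanLin

variable {α ι κ τ : Type*} [Fintype ι] [DecidableEq ι]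

lemma toEuclideanLin_mul_comp [Fintype κ] [DecidableEq κ] (C : Matrix τ κ ℝ) (D : Matrix κ ι ℝ)
    (X : α → EuclideanSpace ℝ ι) :
    Matrix.toEuclideanLin (C * D) ∘ X = Matrix.toEuclideanLin C ∘ Matrix.toEuclideanLin D ∘ X := by
  ext1 ω
  simp [Matrix.toLpLin_apply, Matrix.mulVec_mulVec]

lemma continuous_toEuclideanLin [Finite τ] (C : Matrix τ ι ℝ) :
    Continuous (Matrix.toEuclideanLin C) := by
  have := Fintype.ofFinite τ
  exact LinearMap.continuous_of_finiteDimensional _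

end ToEuclideanLin

section SecondMoments

variable {Ω : Type*} [MeasurableSpace Ω] {μ : Measure Ω} {ι κ τ : Type*}
  {X X' : Ω → EuclideanSpace ℝ ι} {Y Y' : Ω → EuclideanSpace ℝ κ}

/-- The matrix `E[X Yᵀ]` of second moments of two random vectors; its entries are the integrals
that they are supposed to be only for square integrable `X` and `Y`. -/
noncomputable def crossMoment (μ : Measure Ω) (X : Ω → EuclideanSpace ℝ ι)
    (Y : Ω → EuclideanSpace ℝ κ) : Matrix ι κ ℝ :=
  Matrix.of fun i j => ∫ ω, X ω i * Y ω j ∂μ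

lemma crossMoment_transpose : (crossMoment μ X Y)ᵀ = crossMoment μ Y X := by
  ext i j
  simp [crossMoment, mul_comm]

lemma crossMoment_zero_right : crossMoment μ X (0 : Ω → EuclideanSpace ℝ κ) = 0 := by
  ext i j
  simp [crossMoment]

lemma crossMoment_congr (hX : X =ᵐ[μ] X') (hY : Y =ᵐ[μ] Y') :
    crossMoment μ X Y = crossMoment μ X' Y' := by
  ext i j
  refine integral_congr_ae ?_
  filter_upwards [hX, hY] with ω hω hω'
  simp only [hω, hω']

variable [Fintype ι] [Fintype κ]

lemma memLp_coord (hX : MemLp X 2 μ) (i : ι) : MemLp (fun ω => X ω i) 2 μ :=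
  (EuclideanSpace.proj i : EuclideanSpace ℝ ι →L[ℝ] ℝ).comp_memLp' hX

lemma integrable_coord_mul (hX : MemLp X 2 μ) (hY : MemLp Y 2 μ) (i : ι) (j : κ) :
    Integrable (fun ω => X ω i * Y ω j) μ :=
  (memLp_coord hX i).integrable_mul (memLp_coord hY j)

lemma crossMoment_add_left (hX : MemLp X 2 μ) (hX' : MemLp X' 2 μ) (hY : MemLp Y 2 μ) :
    crossMoment μ (X + X') Y = crossMoment μ X Y + crossMoment μ X' Y := by
  ext i j
  simp only [crossMoment, Matrix.of_apply, Matrix.add_apply, Pi.add_apply, PiLp.add_apply, add_mul]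
  exact integral_add (integrable_coord_mul hX hY i j) (integrable_coord_mul hX' hY i j)

lemma crossMoment_add_right (hX : MemLp X 2 μ) (hY : MemLp Y 2 μ) (hY' : MemLp Y' 2 μ) :
    crossMoment μ X (Y + Y') = crossMoment μ X Y + crossMoment μ X Y' := by
  rw [← crossMoment_transpose, crossMoment_add_left hY hY' hX, Matrix.transpose_add,
    crossMoment_transpose, crossMoment_transpose]

lemma crossMoment_sub_left (hX : MemLp X 2 μ) (hX' : MemLp X' 2 μ) (hY : MemLp Y 2 μ) :
    crossMoment μ (X - X') Y = crossMoment μ X Y - crossMoment μ X' Y := by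
  rw [eq_sub_iff_add_eq, ← crossMoment_add_left (hX.sub hX') hX' hY, sub_add_cancel]

lemma crossMoment_sub_right (hX : MemLp X 2 μ) (hY : MemLp Y 2 μ) (hY' : MemLp Y' 2 μ) :
    crossMoment μ X (Y - Y') = crossMoment μ X Y - crossMoment μ X Y' := by
  rw [eq_sub_iff_add_eq, ← crossMoment_add_right hX (hY.sub hY') hY', sub_add_cancel]

lemma trace_crossMoment_self (hX : MemLp X 2 μ) :
    (crossMoment μ X X).trace = ∫ ω, ‖X ω‖ ^ 2 ∂μ := by
  simp only [Matrix.trace, Matrix.diag_apply, crossMoment, Matrix.of_apply]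
  rw [← integral_finsetSum _ fun i _ => integrable_coord_mul hX hX i i]
  refine integral_congr_ae (ae_of_all _ fun ω => ?_)
  simp [EuclideanSpace.norm_sq_eq (X ω), ← pow_two]

lemma trace_crossMoment_self_nonneg : 0 ≤ (crossMoment μ X X).trace :=
  Finset.sum_nonneg fun i _ => integral_nonneg fun ω => mul_self_nonneg (X ω i)

lemma lintegral_norm_sq_eq (hX : MemLp X 2 μ) :
    ∫⁻ ω, ENNReal.ofReal (‖X ω‖ ^ 2) ∂μ = ENNReal.ofReal (crossMoment μ X X).trace := by
  rw [trace_crossMoment_self hX]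
  exact (ofReal_integral_eq_lintegral_ofReal
    ((memLp_two_iff_integrable_sq_norm hX.1).1 hX) (ae_of_all _ fun ω => by positivity)).symm

lemma memLp_two_of_lintegral_norm_sq_ne_top (hX : AEStronglyMeasurable X μ)
    (h : ∫⁻ ω, ENNReal.ofReal (‖X ω‖ ^ 2) ∂μ ≠ ⊤) : MemLp X 2 μ := by
  rw [memLp_two_iff_integrable_sq_norm hX]
  refine ⟨hX.norm.pow 2, ?_⟩
  rw [hasFiniteIntegral_iff_ofReal (ae_of_all _ fun ω => by positivity)]
  exact h.lt_top

lemma trace_crossMoment_le_of_trace_eq_zero (hX : MemLp X 2 μ) (hX' : MemLp X' 2 μ)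
    (h : (crossMoment μ X X').trace = 0) :
    (crossMoment μ X X).trace ≤ (crossMoment μ (X + X') (X + X')).trace := by
  have h' : (crossMoment μ X' X).trace = 0 := by
    rw [← crossMoment_transpose, Matrix.trace_transpose, h]
  rw [crossMoment_add_left hX hX' (hX.add hX'), crossMoment_add_right hX hX hX',
    crossMoment_add_right hX' hX hX', Matrix.trace_add, Matrix.trace_add, Matrix.trace_add, h, h']
  linarith [trace_crossMoment_self_nonneg (μ := μ) (X := X')]

lemma crossMoment_eq_of_orthogonal (hX : MemLp X 2 μ) (hX' : MemLp X' 2 μ)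
    (h : crossMoment μ (X - X') X' = 0) : crossMoment μ X X' = crossMoment μ X' X' := by
  rwa [crossMoment_sub_left hX hX' hX', sub_eq_zero] at h

lemma crossMoment_eq_of_orthogonal' (hX : MemLp X 2 μ) (hX' : MemLp X' 2 μ)
    (h : crossMoment μ (X - X') X' = 0) : crossMoment μ X' X = crossMoment μ X' X' := by
  rw [← crossMoment_transpose, crossMoment_eq_of_orthogonal hX hX' h, crossMoment_transpose]

lemma crossMoment_sub_self_of_orthogonal (hX : MemLp X 2 μ) (hX' : MemLp X' 2 μ)
    (h : crossMoment μ (X - X') X' = 0) :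
    crossMoment μ (X - X') (X - X') = crossMoment μ X X - crossMoment μ X' X' := by
  rw [crossMoment_sub_right (hX.sub hX') hX hX', h, sub_zero, crossMoment_sub_left hX hX' hX,
    crossMoment_eq_of_orthogonal' hX hX' h]

lemma crossMoment_toEuclideanLin_left [DecidableEq ι] (hX : MemLp X 2 μ) (hY : MemLp Y 2 μ)
    (C : Matrix τ ι ℝ) :
    crossMoment μ (Matrix.toEuclideanLin C ∘ X) Y = C * crossMoment μ X Y := by
  ext i j
  simp only [crossMoment, Function.comp_apply, Matrix.of_apply, Matrix.mul_apply,
    Matrix.toLpLin_apply, Matrix.mulVec, dotProduct, Finset.sum_mul]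
  rw [integral_finsetSum _ fun l _ => ?_]
  · refine Finset.sum_congr rfl fun l _ => ?_
    rw [← integral_const_mul]
    simp only [mul_assoc]
  · simpa only [mul_assoc] using (integrable_coord_mul hX hY l j).const_mul (C i l)

lemma crossMoment_toEuclideanLin_right [DecidableEq κ] (hX : MemLp X 2 μ) (hY : MemLp Y 2 μ)
    (C : Matrix τ κ ℝ) :
    crossMoment μ X (Matrix.toEuclideanLin C ∘ Y) = crossMoment μ X Y * Cᵀ := by
  rw [← crossMoment_transpose, crossMoment_toEuclideanLin_left hY hX, Matrix.transpose_mul,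
    crossMoment_transpose]

lemma memLp_toEuclideanLin [DecidableEq ι] [Fintype τ] (hX : MemLp X 2 μ) (C : Matrix τ ι ℝ) :
    MemLp (Matrix.toEuclideanLin C ∘ X) 2 μ :=
  (LinearMap.toContinuousLinearMap (Matrix.toEuclideanLin C)).comp_memLp' hX

lemma crossMoment_toEuclideanLin_self [DecidableEq ι] [Finite τ] (hX : MemLp X 2 μ)
    (C : Matrix τ ι ℝ) :
    crossMoment μ (Matrix.toEuclideanLin C ∘ X) (Matrix.toEuclideanLin C ∘ X) =
      C * crossMoment μ X X * Cᵀ := by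
  have := Fintype.ofFinite τ
  rw [crossMoment_toEuclideanLin_left hX (memLp_toEuclideanLin hX C),
    crossMoment_toEuclideanLin_right hX hX, Matrix.mul_assoc]

lemma crossMoment_self_nonneg (hX : MemLp X 2 μ) : 0 ≤ crossMoment μ X X := by
  classical
  rw [Matrix.nonneg_iff_posSemidef]
  refine .of_dotProduct_mulVec_nonneg ?_ fun v => ?_
  · simpa [Matrix.IsHermitian] using crossMoment_transpose (μ := μ) (X := X) (Y := X)
  · have h := congrFun₂ (crossMoment_toEuclideanLin_self hX (Matrix.replicateRow (Fin 1) v)) 0 0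
    refine (integral_nonneg fun ω => mul_self_nonneg _).trans_eq (h.trans ?_)
    rw [Matrix.mul_assoc, Matrix.mul_apply]
    rfl

lemma crossMoment_le_of_orthogonal (hX : MemLp X 2 μ) (hX' : MemLp X' 2 μ)
    (h : crossMoment μ (X - X') X' = 0) : crossMoment μ X' X' ≤ crossMoment μ X X := by
  rw [← sub_nonneg, ← crossMoment_sub_self_of_orthogonal hX hX' h]
  exact crossMoment_self_nonneg (hX.sub hX')

lemma trace_crossMoment_toEuclideanLin_sub [DecidableEq ι] [Fintype τ] (hX : MemLp X 2 μ)
    (hX' : MemLp X' 2 μ)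
    (h : crossMoment μ (X - X') X' = 0) (C D : Matrix τ ι ℝ) :
    (crossMoment μ (Matrix.toEuclideanLin C ∘ X - Matrix.toEuclideanLin D ∘ X')
      (Matrix.toEuclideanLin C ∘ X - Matrix.toEuclideanLin D ∘ X')).trace =
    (C * crossMoment μ X X * Cᵀ).trace +
      ((Dᵀ * D - Dᵀ * C - Cᵀ * D) * crossMoment μ X' X').trace := by
  have hC := memLp_toEuclideanLin hX C
  have hD := memLp_toEuclideanLin hX' D
  rw [crossMoment_sub_left hC hD (hC.sub hD), crossMoment_sub_right hC hC hD,
    crossMoment_sub_right hD hC hD, crossMoment_toEuclideanLin_self hX,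
    crossMoment_toEuclideanLin_self hX', crossMoment_toEuclideanLin_left hX hD,
    crossMoment_toEuclideanLin_right hX hX', crossMoment_toEuclideanLin_left hX' hC,
    crossMoment_toEuclideanLin_right hX' hX, crossMoment_eq_of_orthogonal hX hX' h,
    crossMoment_eq_of_orthogonal' hX hX' h]
  have cycle (E F : Matrix τ ι ℝ) (S : Matrix ι ι ℝ) :
      (E * (S * Fᵀ)).trace = (Fᵀ * E * S).trace := by
    rw [← Matrix.mul_assoc, Matrix.trace_mul_comm, Matrix.mul_assoc]
  simp only [Matrix.trace_sub, sub_mul, cycle, Matrix.mul_assoc D]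
  ring

end SecondMoments

section ConditionalExpectation

variable {Ω : Type*} {m m' mΩ : MeasurableSpace Ω} {μ : Measure Ω} [IsFiniteMeasure μ]
  {ι κ : Type*} [Fintype ι] [Fintype κ] {X Y : Ω → EuclideanSpace ℝ ι}
  {Z : Ω → EuclideanSpace ℝ κ}

lemma crossMoment_condExp (hm : m ≤ mΩ) (hX : MemLp X 2 μ) (hZ : MemLp Z 2 μ)
    (hZm : StronglyMeasurable[m] Z) : crossMoment μ (μ[X | m]) Z = crossMoment μ X Z := by
  ext i j
  have coord : (fun ω => μ[X | m] ω i) =ᵐ[μ] μ[fun ω => X ω i | m] :=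
    (EuclideanSpace.proj i : EuclideanSpace ℝ ι →L[ℝ] ℝ).comp_condExp_comm
      (hX.integrable (by norm_num))
  have hZj : StronglyMeasurable[m] fun ω => Z ω j :=
    (EuclideanSpace.proj j : EuclideanSpace ℝ κ →L[ℝ] ℝ).continuous.comp_stronglyMeasurable hZm
  have pull : μ[(fun ω => X ω i * Z ω j) | m] =ᵐ[μ] fun ω => μ[X | m] ω i * Z ω j :=
    (condExp_mul_of_stronglyMeasurable_right hZj (integrable_coord_mul hX hZ i j)
      ((memLp_coord hX i).integrable (by norm_num))).trans (coord.symm.mul .rfl)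
  simp only [crossMoment, Matrix.of_apply]
  rw [← integral_congr_ae pull, integral_condExp hm]

lemma crossMoment_sub_condExp (hm : m ≤ mΩ) (hX : MemLp X 2 μ) (hZ : MemLp Z 2 μ)
    (hZm : StronglyMeasurable[m] Z) : crossMoment μ (X - μ[X | m]) Z = 0 := by
  rw [crossMoment_sub_left hX (hX.condExp (by norm_num)) hZ, crossMoment_condExp hm hX hZ hZm,
    sub_self]

lemma crossMoment_condExp_self_le (hm : m ≤ mΩ) (hX : MemLp X 2 μ) :
    crossMoment μ (μ[X | m]) (μ[X | m]) ≤ crossMoment μ X X :=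
  crossMoment_le_of_orthogonal hX (hX.condExp (by norm_num))
    (crossMoment_sub_condExp hm hX (hX.condExp (by norm_num)) stronglyMeasurable_condExp)

lemma crossMoment_condExp_self_mono (hmm' : m ≤ m') (hm' : m' ≤ mΩ) (hX : MemLp X 2 μ) :
    crossMoment μ (μ[X | m]) (μ[X | m]) ≤ crossMoment μ (μ[X | m']) (μ[X | m']) := by
  have tower := condExp_condExp_of_le (μ := μ) (f := X) hmm' hm'
  rw [← crossMoment_congr tower tower]
  exact crossMoment_condExp_self_le (hmm'.trans hm') (hX.condExp (by norm_num))

variable [DecidableEq ι]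

lemma condExp_toEuclideanLin (hX : MemLp X 2 μ) (C : Matrix κ ι ℝ) :
    μ[Matrix.toEuclideanLin C ∘ X | m] =ᵐ[μ] Matrix.toEuclideanLin C ∘ μ[X | m] :=
  ((LinearMap.toContinuousLinearMap (Matrix.toEuclideanLin C)).comp_condExp_comm
    (hX.integrable (by norm_num))).symm

lemma trace_crossMoment_sub_projection_condExp (hm : m ≤ mΩ) (hX : MemLp X 2 μ)
    (hY : MemLp Y 2 μ) (hYm : StronglyMeasurable[m] Y) {P : Matrix ι ι ℝ}
    (hP : IsStarProjection P) (hPY : Matrix.toEuclideanLin P ∘ Y = Y) :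
    (crossMoment μ (X - Matrix.toEuclideanLin P ∘ μ[X | m]) Y).trace = 0 := by
  have hXhat : MemLp (μ[X | m]) 2 μ := hX.condExp (by norm_num)
  have hPX := memLp_toEuclideanLin hXhat P
  have orthogonal := crossMoment_sub_condExp hm hX hY hYm
  rw [crossMoment_sub_left hX hXhat hY, sub_eq_zero] at orthogonal
  have hPT : Pᵀ = P := hP.isSelfAdjoint.star_eq
  rw [crossMoment_sub_left hX hPX hY, crossMoment_toEuclideanLin_left hXhat hY, ← orthogonal]
  nth_rw 1 [← hPY]
  rw [crossMoment_toEuclideanLin_right hX hY, hPT, Matrix.trace_sub, Matrix.trace_mul_comm,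
    sub_self]

lemma lintegral_norm_sub_projection_condExp_sq_le (hm : m ≤ mΩ) (hX : MemLp X 2 μ)
    (hYm : Measurable[m] Y) {P : Matrix ι ι ℝ} (hP : IsStarProjection P)
    (hPY : Matrix.toEuclideanLin P ∘ Y = Y) :
    ∫⁻ ω, ENNReal.ofReal (‖(X - Matrix.toEuclideanLin P ∘ μ[X | m]) ω‖ ^ 2) ∂μ ≤
      ∫⁻ ω, ENNReal.ofReal (‖(X + Y) ω‖ ^ 2) ∂μ := by
  by_cases htop : ∫⁻ ω, ENNReal.ofReal (‖(X + Y) ω‖ ^ 2) ∂μ = ⊤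
  · simp only [htop, le_top]
  have hY : MemLp Y 2 μ := by
    have hXY := memLp_two_of_lintegral_norm_sq_ne_top
      (hX.1.add (hYm.mono hm le_rfl).aestronglyMeasurable) htop
    simpa only [add_sub_cancel_left] using hXY.sub hX
  have hPX := memLp_toEuclideanLin (hX.condExp (m := m) (by norm_num)) P
  set PX := Matrix.toEuclideanLin P ∘ μ[X | m] with hPX_def
  have hm_sum : StronglyMeasurable[m] (Y + PX) := hYm.stronglyMeasurable.add
    ((continuous_toEuclideanLin P).comp_stronglyMeasurable stronglyMeasurable_condExp)
  have hP_sum : Matrix.toEuclideanLin P ∘ (Y + PX) = Y + PX := by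
    have hPPX : Matrix.toEuclideanLin P ∘ PX = PX := by
      rw [hPX_def, ← toEuclideanLin_mul_comp, hP.isIdempotentElem.eq]
    conv_rhs => rw [← hPY, ← hPPX]
    exact funext fun ω => map_add _ _ _
  have hsplit : X + Y = (X - PX) + (Y + PX) := by abel
  have hsub := hX.sub hPX
  have hadd := hY.add hPX
  rw [hsplit, lintegral_norm_sq_eq hsub, lintegral_norm_sq_eq (hsub.add hadd)]
  exact ENNReal.ofReal_le_ofReal (trace_crossMoment_le_of_trace_eq_zero hsub hadd
    (trace_crossMoment_sub_projection_condExp hm hX hadd hm_sum hP hP_sum))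

end ConditionalExpectation

/-! ### Estimates and best responses -/

section Estimates

variable {Ω : Type*} [mΩ : MeasurableSpace Ω] {μ : Measure Ω} {m p : ℕ}
  {x : ℕ → Ω → EuclideanSpace ℝ (Fin p)} {η η' : SenderProfile m p} {k : ℕ}

/-- The information that the receiver has at stage `k`, as a σ-algebra. -/
abbrev receiverInfo (x : ℕ → Ω → EuclideanSpace ℝ (Fin p)) (η : SenderProfile m p) (k : ℕ) :
    MeasurableSpace Ω :=
  MeasurableSpace.comap (messages x η k) inferInstance

lemma measurable_messages (hx : ∀ l ≤ k, Measurable (x l)) : Measurable (messages x η k) := by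
  refine measurable_pi_lambda _ fun j => measurable_pi_lambda _ fun i => ?_
  exact (η i (j + 1)).2.comp (measurable_pi_lambda _ fun l => hx _ (by omega))

lemma receiverInfo_le (hx : ∀ l ≤ k, Measurable (x l)) : receiverInfo x η k ≤ mΩ :=
  (measurable_messages hx).comap_le

lemma memLp_estimate (hx : MemLp (x k) 2 μ) : MemLp (estimate μ x η k) 2 μ :=
  hx.condExp (by norm_num)

lemma exists_estimate_eq_comp (μ : Measure Ω) (x : ℕ → Ω → EuclideanSpace ℝ (Fin p))
    (η : SenderProfile m p) (k : ℕ) :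
    ∃ f : (Fin k → Fin m → EuclideanSpace ℝ (Fin p)) → EuclideanSpace ℝ (Fin p),
      Measurable f ∧ estimate μ x η k = f ∘ messages x η k := by
  obtain ⟨f, hf, hfe⟩ := (stronglyMeasurable_condExp (μ := μ) (f := x k)
    (m := receiverInfo x η k)).exists_eq_measurable_comp
  exact ⟨f, hf.measurable, hfe⟩

variable [IsFiniteMeasure μ]

lemma crossMoment_sub_estimate (hm : ∀ l ≤ k, Measurable (x l)) (hx : MemLp (x k) 2 μ) :
    crossMoment μ (x k - estimate μ x η k) (estimate μ x η k) = 0 :=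
  crossMoment_sub_condExp (receiverInfo_le hm) hx (memLp_estimate hx) stronglyMeasurable_condExp

lemma posteriorCov_le (hm : ∀ l ≤ k, Measurable (x l)) (hx : MemLp (x k) 2 μ) :
    posteriorCov μ x η k ≤ crossMoment μ (x k) (x k) :=
  crossMoment_condExp_self_le (receiverInfo_le hm) hx

lemma posteriorCov_mono (hm : ∀ l ≤ k, Measurable (x l)) (hx : MemLp (x k) 2 μ)
    (h : receiverInfo x η k ≤ receiverInfo x η' k) :
    posteriorCov μ x η k ≤ posteriorCov μ x η' k :=
  crossMoment_condExp_self_mono h (receiverInfo_le hm) hx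

end Estimates

lemma isStarProjection_mul_inv_mul_transpose {ι κ : Type*} [Fintype ι] [Fintype κ]
    [DecidableEq κ] {R : Matrix ι κ ℝ} (hR : IsUnit (Rᵀ * R)) :
    IsStarProjection (R * (Rᵀ * R)⁻¹ * Rᵀ) := by
  have hdet : IsUnit (Rᵀ * R).det := (Matrix.isUnit_iff_isUnit_det _).1 hR
  refine ⟨?_, ?_⟩
  · calc R * (Rᵀ * R)⁻¹ * Rᵀ * (R * (Rᵀ * R)⁻¹ * Rᵀ)
        = R * ((Rᵀ * R)⁻¹ * (Rᵀ * R)) * (Rᵀ * R)⁻¹ * Rᵀ := by simp only [Matrix.mul_assoc]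
      _ = R * (Rᵀ * R)⁻¹ * Rᵀ := by rw [Matrix.nonsing_inv_mul _ hdet, Matrix.mul_one]
  · change (R * (Rᵀ * R)⁻¹ * Rᵀ)ᵀ = _
    simp only [Matrix.transpose_mul, Matrix.transpose_transpose, Matrix.transpose_nonsing_inv,
      Matrix.mul_assoc]

namespace SignalingGame

variable {m p t q : ℕ} {G : SignalingGame m p t q}
variable {Ω : Type*} [mΩ : MeasurableSpace Ω] {μ : Measure Ω}
  {x : ℕ → Ω → EuclideanSpace ℝ (Fin p)} {η : SenderProfile m p} {g : ReceiverPolicy m p t} {k : ℕ}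

/-- Expected cost of player `j` at stage `k`. -/
noncomputable def stageCost (G : SignalingGame m p t q) (μ : Measure Ω)
    (x : ℕ → Ω → EuclideanSpace ℝ (Fin p)) (j : Option (Fin m)) (k : ℕ) (η : SenderProfile m p)
    (g : ReceiverPolicy m p t) : ENNReal :=
  ∫⁻ ω, ENNReal.ofReal (‖Matrix.toEuclideanLin (G.Q j k) (x k ω) +
    Matrix.toEuclideanLin (G.R j k) ((g k).1 (messages x η k ω))‖ ^ 2) ∂μ

lemma cost_eq_sum_stageCost (hm : ∀ l ≤ G.n, Measurable (x l)) (j : Option (Fin m))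
    {s : Finset ℕ} (hs : ∀ k ∈ s, k ≤ G.n) (η : SenderProfile m p) (g : ReceiverPolicy m p t) :
    G.cost μ x j s η g = ∑ k ∈ s, G.stageCost μ x j k η g := by
  refine lintegral_finsetSum' _ fun k hk => Measurable.aemeasurable ?_
  have hmsg : Measurable (messages x η k) :=
    measurable_messages fun l hl => hm l (hl.trans (hs k hk))
  exact ((((continuous_toEuclideanLin _).measurable.comp (hm k (hs k hk))).add
    ((continuous_toEuclideanLin _).measurable.comp ((g k).2.comp hmsg))).norm.pow_const
      2).ennreal_ofReal

/-- The matrix `(RᵀR)⁻¹ Rᵀ Q` of the receiver: the best response to the estimate `v` of the state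
is the action `-(RᵀR)⁻¹ Rᵀ Q v`. -/
noncomputable def gain (G : SignalingGame m p t q) (k : ℕ) : Matrix (Fin t) (Fin p) ℝ :=
  ((G.R none k)ᵀ * G.R none k)⁻¹ * (G.R none k)ᵀ * G.Q none k

/-- `g` answers the profile `η` with the certainty equivalent action at each stage. -/
def RespondsTo (G : SignalingGame m p t q) (μ : Measure Ω)
    (x : ℕ → Ω → EuclideanSpace ℝ (Fin p)) (η : SenderProfile m p)
    (g : ReceiverPolicy m p t) : Prop :=
  ∀ k ω, (g k).1 (messages x η k ω) = -Matrix.toEuclideanLin (G.gain k) (estimate μ x η k ω)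

lemma exists_respondsTo (G : SignalingGame m p t q) (μ : Measure Ω)
    (x : ℕ → Ω → EuclideanSpace ℝ (Fin p)) (η : SenderProfile m p) :
    ∃ g : ReceiverPolicy m p t, G.RespondsTo μ x η g := by
  choose f hf hfe using exists_estimate_eq_comp μ x η
  refine ⟨fun k => ⟨fun y => -Matrix.toEuclideanLin (G.gain k) (f k y),
    ((continuous_toEuclideanLin _).measurable.comp (hf k)).neg⟩, fun k ω => ?_⟩
  rw [hfe k, Function.comp_apply]

lemma RespondsTo.stageCost_eq (h : G.RespondsTo μ x η g) (j : Option (Fin m)) (k : ℕ) :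
    G.stageCost μ x j k η g = ∫⁻ ω, ENNReal.ofReal (‖Matrix.toEuclideanLin (G.Q j k) (x k ω) -
      Matrix.toEuclideanLin (G.R j k * G.gain k) (estimate μ x η k ω)‖ ^ 2) ∂μ := by
  refine lintegral_congr fun ω => ?_
  have hcomp := congrFun (toEuclideanLin_mul_comp (G.R j k) (G.gain k) (estimate μ x η k)) ω
  simp only [Function.comp_apply] at hcomp
  rw [h k ω, map_neg, hcomp, sub_eq_add_neg]

variable [IsFiniteMeasure μ]

lemma RespondsTo.stageCost_receiver_le (h : G.RespondsTo μ x η g) (hk : k ∈ Finset.Icc 1 G.n)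
    (hm : ∀ l ≤ k, Measurable (x l)) (hx : MemLp (x k) 2 μ) (g' : ReceiverPolicy m p t) :
    G.stageCost μ x none k η g ≤ G.stageCost μ x none k η g' := by
  set R := G.R none k with hR
  set P := R * (Rᵀ * R)⁻¹ * Rᵀ with hP
  have hRgain : R * G.gain k = P * G.Q none k := by
    simp only [gain, hP, ← hR, Matrix.mul_assoc]
  have hPR : P * R = R := by
    have hdet : IsUnit (Rᵀ * R).det := (Matrix.isUnit_iff_isUnit_det _).1 (G.isUnit_receiver k hk)
    rw [hP, Matrix.mul_assoc, Matrix.mul_assoc, Matrix.nonsing_inv_mul _ hdet, Matrix.mul_one]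
  let Y := Matrix.toEuclideanLin R ∘ (g' k).1 ∘ messages x η k
  have hYm : Measurable[receiverInfo x η k] Y :=
    (continuous_toEuclideanLin R).measurable.comp ((g' k).2.comp (comap_measurable _))
  have hPY : Matrix.toEuclideanLin P ∘ Y = Y := by
    rw [← toEuclideanLin_mul_comp, hPR]
  have hX := memLp_toEuclideanLin hx (G.Q none k)
  refine le_trans (le_of_eq ?_) (lintegral_norm_sub_projection_condExp_sq_le (receiverInfo_le hm)
    hX hYm (isStarProjection_mul_inv_mul_transpose (G.isUnit_receiver k hk)) hPY)
  rw [h.stageCost_eq, ← hR, hRgain]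
  refine lintegral_congr_ae ?_
  filter_upwards [condExp_toEuclideanLin (m := receiverInfo x η k) hx (G.Q none k)] with ω hω
  have hcomp := congrFun (toEuclideanLin_mul_comp P (G.Q none k) (estimate μ x η k)) ω
  simp only [Function.comp_apply] at hcomp hω
  rw [hcomp, Pi.sub_apply, Function.comp_apply, Function.comp_apply, hω, estimate]

lemma RespondsTo.stageCost_sender (h : G.RespondsTo μ x η g) (hm : ∀ l ≤ k, Measurable (x l))
    (hx : MemLp (x k) 2 μ) (i : Fin m) :
    G.stageCost μ x (some i) k η g =
      ENNReal.ofReal ((G.Q (some i) k * crossMoment μ (x k) (x k) * (G.Q (some i) k)ᵀ).trace +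
        (G.V i k * posteriorCov μ x η k).trace) := by
  have hlam : G.R (some i) k * G.gain k = G.lam i k := by
    simp only [gain, lam, Matrix.mul_assoc]
  have hest := memLp_estimate (η := η) hx
  rw [h.stageCost_eq, hlam]
  refine (lintegral_norm_sq_eq
    ((memLp_toEuclideanLin hx _).sub (memLp_toEuclideanLin hest _))).trans ?_
  exact congrArg ENNReal.ofReal
    (trace_crossMoment_toEuclideanLin_sub hx hest (crossMoment_sub_estimate hm hx) _ _)

end SignalingGame

/-! ### Gaussian vectors -/

section LinearFunctions

variable {Ω F E E' T : Type*} [NormedAddCommGroup F] [NormedSpace ℝ F] [NormedAddCommGroup E]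
  [NormedSpace ℝ E] [NormedAddCommGroup E'] [NormedSpace ℝ E'] {Z : Ω → F} {X : Ω → E}

/-- The random vectors `L ∘ Z` with `L` linear.  If `Z` is a centered Gaussian vector, then all of
them are centered and jointly Gaussian. -/
def linearFunctions (Z : Ω → F) (E : Type*) [NormedAddCommGroup E] [NormedSpace ℝ E] :
    Submodule ℝ (Ω → E) where
  carrier := {X | ∃ L : F →L[ℝ] E, X = L ∘ Z}
  zero_mem' := ⟨0, rfl⟩
  add_mem' := by
    rintro _ _ ⟨L, rfl⟩ ⟨L', rfl⟩
    exact ⟨L + L', rfl⟩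
  smul_mem' := by
    rintro c _ ⟨L, rfl⟩
    exact ⟨c • L, rfl⟩

lemma comp_mem_linearFunctions (hX : X ∈ linearFunctions Z E) (C : E →L[ℝ] E') :
    C ∘ X ∈ linearFunctions Z E' := by
  obtain ⟨L, rfl⟩ := hX
  exact ⟨C ∘L L, rfl⟩

lemma toEuclideanLin_comp_mem_linearFunctions {ι κ : Type*} [Fintype ι] [DecidableEq ι]
    [Fintype κ] {X : Ω → EuclideanSpace ℝ ι} (hX : X ∈ linearFunctions Z (EuclideanSpace ℝ ι))
    (C : Matrix κ ι ℝ) :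
    Matrix.toEuclideanLin C ∘ X ∈ linearFunctions Z (EuclideanSpace ℝ κ) :=
  comp_mem_linearFunctions hX (LinearMap.toContinuousLinearMap (Matrix.toEuclideanLin C))

variable [MeasurableSpace F] [BorelSpace F] [MeasurableSpace Ω] {μ : Measure Ω}

lemma integral_eq_zero_of_mem_linearFunctions [CompleteSpace F] [SecondCountableTopology F]
    [CompleteSpace E] (hX : X ∈ linearFunctions Z E) (hZ : HasGaussianLaw Z μ)
    (h0 : ∫ ω, Z ω ∂μ = 0) : ∫ ω, X ω ∂μ = 0 := by
  obtain ⟨L, rfl⟩ := hX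
  exact (L.integral_comp_comm hZ.integrable).trans (by rw [h0, map_zero])

variable [MeasurableSpace E] [BorelSpace E]

lemma measurable_of_mem_linearFunctions (hX : X ∈ linearFunctions Z E) (hZ : Measurable Z) :
    Measurable X := by
  obtain ⟨L, rfl⟩ := hX
  exact L.continuous.measurable.comp hZ

lemma hasGaussianLaw_of_mem_linearFunctions (hX : X ∈ linearFunctions Z E)
    (hZ : HasGaussianLaw Z μ) : HasGaussianLaw X μ := by
  obtain ⟨L, rfl⟩ := hX
  exact hZ.map L

lemma isGaussianProcess_of_mem_linearFunctions [SecondCountableTopology E] {Y : T → Ω → E}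
    (hY : ∀ t, Y t ∈ linearFunctions Z E) (hZ : HasGaussianLaw Z μ) : IsGaussianProcess Y μ where
  hasGaussianLaw I := by
    choose L hL using fun t => (hY t : ∃ L : F →L[ℝ] E, Y t = L ∘ Z)
    obtain rfl : Y = fun t => L t ∘ Z := funext hL
    exact hZ.map (ContinuousLinearMap.pi fun i : I => L i)

lemma indepFun_of_crossMoment_eq_zero [CompleteSpace F] [SecondCountableTopology F]
    {ι κ : Type*} [Fintype ι] [Fintype κ] {X : Ω → EuclideanSpace ℝ ι}
    {Y : T → Ω → EuclideanSpace ℝ κ} (hX : X ∈ linearFunctions Z (EuclideanSpace ℝ ι))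
    (hY : ∀ t, Y t ∈ linearFunctions Z (EuclideanSpace ℝ κ)) (hZ : HasGaussianLaw Z μ)
    (hZm : Measurable Z) (h0 : ∫ ω, Z ω ∂μ = 0) (h : ∀ t, crossMoment μ X (Y t) = 0) :
    IndepFun X (fun ω t => Y t ω) μ := by
  let X' : ι → Ω → ℝ := fun i ω => X ω i
  let Y' : T × κ → Ω → ℝ := fun c ω => Y c.1 ω c.2
  have hX' (i) : X' i ∈ linearFunctions Z ℝ := comp_mem_linearFunctions hX (EuclideanSpace.proj i)
  have hY' (c) : Y' c ∈ linearFunctions Z ℝ :=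
    comp_mem_linearFunctions (hY c.1) (EuclideanSpace.proj c.2)
  have hXY : IsGaussianProcess (Sum.elim X' Y') μ :=
    isGaussianProcess_of_mem_linearFunctions (Sum.rec hX' hY') hZ
  have hind := hXY.indepFun_of_covariance_eq_zero
    (fun i => (measurable_of_mem_linearFunctions (hX' i) hZm).aemeasurable)
    (fun c => (measurable_of_mem_linearFunctions (hY' c) hZm).aemeasurable) fun i c => ?_
  · exact hind.comp (φ := fun v : ι → ℝ => WithLp.toLp 2 v)
      (ψ := fun (v : T × κ → ℝ) t => WithLp.toLp 2 fun j => v (t, j)) (by fun_prop) (by fun_prop)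
  · have := hZ.isProbabilityMeasure
    rw [covariance_eq_sub (hasGaussianLaw_of_mem_linearFunctions (hX' i) hZ).memLp_two
      (hasGaussianLaw_of_mem_linearFunctions (hY' c) hZ).memLp_two,
      integral_eq_zero_of_mem_linearFunctions (hX' i) hZ h0, zero_mul, sub_zero]
    exact congrFun₂ (h c.1) i c.2

end LinearFunctions

section GaussianMoments

variable {Ω : Type*} [MeasurableSpace Ω] {μ : Measure Ω} {ι κ : Type*} [Fintype ι] [Fintype κ]
  {X : Ω → EuclideanSpace ℝ ι} {Y : Ω → EuclideanSpace ℝ κ}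

lemma integral_coord_eq_zero (hX : Integrable X μ) (h : ∫ ω, X ω ∂μ = 0) (i : ι) :
    ∫ ω, X ω i ∂μ = 0 :=
  ((EuclideanSpace.proj i : EuclideanSpace ℝ ι →L[ℝ] ℝ).integral_comp_comm hX).trans
    (by rw [h, map_zero])

lemma crossMoment_eq_zero_of_indepFun [IsFiniteMeasure μ] (hX : MemLp X 2 μ) (hY : MemLp Y 2 μ)
    (h0 : ∫ ω, X ω ∂μ = 0) (h : IndepFun X Y μ) : crossMoment μ X Y = 0 := by
  ext i j
  have hij : IndepFun (fun ω => X ω i) (fun ω => Y ω j) μ :=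
    h.comp (φ := fun v : EuclideanSpace ℝ ι => v i) (ψ := fun v : EuclideanSpace ℝ κ => v j)
      (by fun_prop) (by fun_prop)
  refine (hij.integral_fun_mul_eq_mul_integral (memLp_coord hX i).1 (memLp_coord hY j).1).trans ?_
  rw [integral_coord_eq_zero (hX.integrable (by norm_num)) h0, zero_mul, Matrix.zero_apply]

variable [DecidableEq ι] {S : Matrix ι ι ℝ}

lemma hasGaussianLaw_of_map_eq {v : EuclideanSpace ℝ ι} (h : μ.map X = multivariateGaussian v S) :
    HasGaussianLaw X μ where
  isGaussian_map := by rw [h]; infer_instance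

lemma integral_eq_of_map_eq_multivariateGaussian {v : EuclideanSpace ℝ ι} (hX : Measurable X)
    (h : μ.map X = multivariateGaussian v S) : ∫ ω, X ω ∂μ = v := by
  rw [← integral_map (f := fun y => y) hX.aemeasurable (by fun_prop), h,
    integral_id_multivariateGaussian]

lemma crossMoment_eq_of_map_eq_multivariateGaussian (hX : Measurable X) (hS : S.PosSemidef)
    (h : μ.map X = multivariateGaussian 0 S) : crossMoment μ X X = S := by
  have hG := hasGaussianLaw_of_map_eq h
  have := hG.isProbabilityMeasure
  ext i j
  have hcov := covariance_eval_multivariateGaussian (μ := 0) hS i j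
  rw [← h, covariance_map (by fun_prop) (by fun_prop) hX.aemeasurable] at hcov
  have hprod := covariance_eq_sub (memLp_coord hG.memLp_two i) (memLp_coord hG.memLp_two j)
  rw [integral_coord_eq_zero hG.integrable (integral_eq_of_map_eq_multivariateGaussian hX h),
    zero_mul, sub_zero] at hprod
  exact hprod.symm.trans hcov

end GaussianMoments

/-! ### The filtering policy -/

section KalmanGain

variable {p : ℕ} {N D : Matrix (Fin p) (Fin p) ℝ}

/-- The gain `D N⁺`, with the Moore-Penrose inverse of `N`.  Applied to an innovation of covariance
`N` it yields the update of covariance `D` that `D` prescribes when `whiten N D` is a projection. -/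
noncomputable def kalmanGain (N D : Matrix (Fin p) (Fin p) ℝ) : Matrix (Fin p) (Fin p) ℝ :=
  D * (invSqrt N * invSqrt N)

lemma kalmanGain_mul (h0 : 0 ≤ D) (h : D ≤ N) : kalmanGain N D * N = D := by
  have hN := h0.trans h
  calc kalmanGain N D * N
      = D * (invSqrt N * (invSqrt N * CFC.sqrt N) * CFC.sqrt N) := by
        nth_rw 2 [← CFC.sqrt_mul_sqrt_self N hN]
        simp only [kalmanGain, mul_assoc]
    _ = D := by
        rw [← supportProj, invSqrt_mul_supportProj hN, ← supportProj, mul_supportProj h0 h]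

lemma mul_kalmanGain_transpose (h0 : 0 ≤ D) (h : D ≤ N) : N * (kalmanGain N D)ᵀ = D := by
  have := congrArg Matrix.transpose (kalmanGain_mul h0 h)
  rwa [Matrix.transpose_mul, transpose_eq_of_nonneg (h0.trans h), transpose_eq_of_nonneg h0] at this

lemma kalmanGain_mul_self (h0 : 0 ≤ D) (h : D ≤ N) (hP : IsStarProjection (whiten N D)) :
    kalmanGain N D * D = D := by
  have hN := h0.trans h
  calc kalmanGain N D * D
      = CFC.sqrt N * whiten N D * CFC.sqrt N * (invSqrt N * invSqrt N) *
          (CFC.sqrt N * whiten N D * CFC.sqrt N) := by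
        rw [sqrt_conj_whiten h0 h, kalmanGain]
    _ = CFC.sqrt N * whiten N D * (supportProj N * supportProj N) *
          whiten N D * CFC.sqrt N := by
        nth_rw 1 [← sqrt_mul_invSqrt hN]
        simp only [supportProj, mul_assoc]
    _ = CFC.sqrt N * (whiten N D * whiten N D) * CFC.sqrt N := by
        rw [(isStarProjection_supportProj hN).isIdempotentElem.eq, whiten]
        simp only [mul_assoc]
        rw [← mul_assoc (supportProj N) (invSqrt N), supportProj_mul_invSqrt hN]
    _ = D := by rw [hP.isIdempotentElem.eq, sqrt_conj_whiten h0 h]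

lemma kalmanGain_mul_mul_transpose (h0 : 0 ≤ D) (h : D ≤ N) (hP : IsStarProjection (whiten N D)) :
    kalmanGain N D * N * (kalmanGain N D)ᵀ = D := by
  rw [mul_assoc, mul_kalmanGain_transpose h0 h, kalmanGain_mul_self h0 h hP]

end KalmanGain

section LinearUpdate

variable {Ω : Type*} [MeasurableSpace Ω] {μ : Measure Ω} {ι κ : Type*} [Fintype ι] [Fintype κ]
  [DecidableEq κ] {X : Ω → EuclideanSpace ℝ ι} {Y : Ω → EuclideanSpace ℝ κ}

lemma crossMoment_add_toEuclideanLin_self (hX : MemLp X 2 μ) (hY : MemLp Y 2 μ)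
    (h : crossMoment μ Y X = 0) (K : Matrix ι κ ℝ) :
    crossMoment μ (X + Matrix.toEuclideanLin K ∘ Y) (X + Matrix.toEuclideanLin K ∘ Y) =
      crossMoment μ X X + K * crossMoment μ Y Y * Kᵀ := by
  have hKY := memLp_toEuclideanLin hY K
  have h' : crossMoment μ X Y = 0 := by rw [← crossMoment_transpose, h, Matrix.transpose_zero]
  rw [crossMoment_add_left hX hKY (hX.add hKY), crossMoment_add_right hX hX hKY,
    crossMoment_add_right hKY hX hKY, crossMoment_toEuclideanLin_self hY,
    crossMoment_toEuclideanLin_left hY hX, crossMoment_toEuclideanLin_right hX hY, h, h',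
    Matrix.mul_zero, Matrix.zero_mul, add_zero, zero_add]

variable [DecidableEq ι] {X' : Ω → EuclideanSpace ℝ ι}

lemma crossMoment_sub_toEuclideanLin_update (hX : MemLp X 2 μ) (hX' : MemLp X' 2 μ)
    (h : crossMoment μ X' X = 0) {K : Matrix ι ι ℝ}
    (hK : K * crossMoment μ X' X' * Kᵀ = crossMoment μ X' X' * Kᵀ) :
    crossMoment μ (X' - Matrix.toEuclideanLin K ∘ X') (X + Matrix.toEuclideanLin K ∘ X') = 0 := by
  have hKX := memLp_toEuclideanLin hX' K
  rw [crossMoment_add_right (hX'.sub hKX) hX hKX, crossMoment_sub_left hX' hKX hX,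
    crossMoment_sub_left hX' hKX hKX, crossMoment_toEuclideanLin_self hX',
    crossMoment_toEuclideanLin_left hX' hX, crossMoment_toEuclideanLin_right hX' hX', h, hK,
    Matrix.mul_zero, sub_self, sub_self, add_zero]

end LinearUpdate

namespace SignalingGame

variable {m p t q : ℕ} {G : SignalingGame m p t q} {Ω F : Type*} [MeasurableSpace Ω]
  {μ : Measure Ω} [NormedAddCommGroup F] [NormedSpace ℝ F] [MeasurableSpace F]
  {x w : ℕ → Ω → EuclideanSpace ℝ (Fin p)} {Z : Ω → F}

/-- What the filtering argument uses about the state: the initial state and the noises are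
uncorrelated linear functions of one centered Gaussian vector `Z`. -/
structure IsLinearGaussianState (G : SignalingGame m p t q) (μ : Measure Ω)
    (x w : ℕ → Ω → EuclideanSpace ℝ (Fin p)) (Z : Ω → F) : Prop where
  hasGaussianLaw : HasGaussianLaw Z μ
  measurable : Measurable Z
  integral_eq_zero : ∫ ω, Z ω ∂μ = 0
  initial_mem : x 0 ∈ linearFunctions Z (EuclideanSpace ℝ (Fin p))
  noise_mem : ∀ k < G.n, w k ∈ linearFunctions Z (EuclideanSpace ℝ (Fin p))
  step : ∀ k < G.n, x (k + 1) = Matrix.toEuclideanLin G.A ∘ x k + w k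
  crossMoment_initial : crossMoment μ (x 0) (x 0) = G.cov0
  crossMoment_noise : ∀ k < G.n, crossMoment μ (w k) (w k) = G.covW
  crossMoment_noise_initial : ∀ k < G.n, crossMoment μ (w k) (x 0) = 0
  crossMoment_noise_noise : ∀ k < G.n, ∀ l < k, crossMoment μ (w k) (w l) = 0

lemma IsGaussMarkovState.exists_isLinearGaussianState [IsFiniteMeasure μ]
    (hx : G.IsGaussMarkovState μ x) :
    ∃ (w : ℕ → Ω → EuclideanSpace ℝ (Fin p))
      (Z : Ω → Fin (G.n + 1) → EuclideanSpace ℝ (Fin p)), G.IsLinearGaussianState μ x w Z := by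
  obtain ⟨w, hx0, hw, hlx, hlw, hind, hstep⟩ := hx
  let Z : Fin (G.n + 1) → Ω → EuclideanSpace ℝ (Fin p) := Fin.cons (x 0) fun j : Fin G.n => w j
  have hm : ∀ i, Measurable (Z i) := Fin.cases hx0 fun j => hw j j.2
  have hg : ∀ i, HasGaussianLaw (Z i) μ :=
    Fin.cases (hasGaussianLaw_of_map_eq hlx) fun j => hasGaussianLaw_of_map_eq (hlw j j.2)
  have h0 : ∀ i, ∫ ω, Z i ω ∂μ = 0 :=
    Fin.cases (integral_eq_of_map_eq_multivariateGaussian hx0 hlx)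
      fun j => integral_eq_of_map_eq_multivariateGaussian (hw j j.2) (hlw j j.2)
  have hG : HasGaussianLaw (fun ω => (Z · ω)) μ := hind.hasGaussianLaw hg
  have hmem (i) : Z i ∈ linearFunctions (fun ω => (Z · ω)) (EuclideanSpace ℝ (Fin p)) :=
    ⟨ContinuousLinearMap.proj i, rfl⟩
  have huncorr {i j} (hij : i ≠ j) : crossMoment μ (Z i) (Z j) = 0 :=
    crossMoment_eq_zero_of_indepFun (hg i).memLp_two (hg j).memLp_two (h0 i) (hind.indepFun hij)
  refine ⟨w, fun ω => (Z · ω), hG, measurable_pi_lambda _ hm, funext fun i => ?_, hmem 0,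
    fun k hk => hmem (Fin.succ ⟨k, hk⟩), fun k hk => funext (hstep k hk),
    crossMoment_eq_of_map_eq_multivariateGaussian hx0 G.cov0_posSemidef hlx,
    fun k hk => crossMoment_eq_of_map_eq_multivariateGaussian (hw k hk) G.covW_posSemidef
      (hlw k hk),
    fun k hk => huncorr (Fin.succ_ne_zero ⟨k, hk⟩), fun k hk l hl => ?_⟩
  · exact ((ContinuousLinearMap.proj (R := ℝ) (φ := fun _ : Fin (G.n + 1) =>
      EuclideanSpace ℝ (Fin p)) i).integral_comp_comm hG.integrable).symm.trans (h0 i)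
  · have hkl : (⟨k, hk⟩ : Fin G.n) ≠ ⟨l, hl.trans hk⟩ := fun h => hl.ne' (congrArg Fin.val h)
    exact huncorr ((Fin.succ_injective _).ne hkl)

namespace IsLinearGaussianState

variable {k : ℕ}

lemma state_mem (h : G.IsLinearGaussianState μ x w Z) (hk : k ≤ G.n) :
    x k ∈ linearFunctions Z (EuclideanSpace ℝ (Fin p)) := by
  induction k with
  | zero => exact h.initial_mem
  | succ k ih =>
    rw [h.step k hk]
    exact add_mem (toEuclideanLin_comp_mem_linearFunctions (ih (Nat.le_of_succ_le hk)) G.A)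
      (h.noise_mem k hk)

variable [BorelSpace F]

lemma memLp_of_mem {X : Ω → EuclideanSpace ℝ (Fin p)} (h : G.IsLinearGaussianState μ x w Z)
    (hX : X ∈ linearFunctions Z (EuclideanSpace ℝ (Fin p))) : MemLp X 2 μ :=
  (hasGaussianLaw_of_mem_linearFunctions hX h.hasGaussianLaw).memLp_two

lemma memLp_state (h : G.IsLinearGaussianState μ x w Z) (hk : k ≤ G.n) : MemLp (x k) 2 μ :=
  h.memLp_of_mem (h.state_mem hk)

lemma measurable_state (h : G.IsLinearGaussianState μ x w Z) (hk : k ≤ G.n) : Measurable (x k) :=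
  measurable_of_mem_linearFunctions (h.state_mem hk) h.measurable

lemma crossMoment_noise_state (h : G.IsLinearGaussianState μ x w Z) (hk : k < G.n) {l : ℕ}
    (hl : l ≤ k) : crossMoment μ (w k) (x l) = 0 := by
  induction l with
  | zero => exact h.crossMoment_noise_initial k hk
  | succ l ih =>
    have hw := h.memLp_of_mem (h.noise_mem k hk)
    have hxl := h.memLp_state (k := l) (by omega)
    rw [h.step l (by omega), crossMoment_add_right hw (memLp_toEuclideanLin hxl G.A)
      (h.memLp_of_mem (h.noise_mem l (by omega))), crossMoment_toEuclideanLin_right hw hxl,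
      ih (by omega), h.crossMoment_noise_noise k hk l hl, Matrix.zero_mul, add_zero]

lemma crossMoment_state (h : G.IsLinearGaussianState μ x w Z) (hk : k ≤ G.n) :
    crossMoment μ (x k) (x k) = G.stateCov k := by
  induction k with
  | zero => exact h.crossMoment_initial
  | succ k ih =>
    have hxw : crossMoment μ (x k) (w k) = 0 := by
      rw [← crossMoment_transpose, h.crossMoment_noise_state hk le_rfl, Matrix.transpose_zero]
    rw [h.step k hk, add_comm, crossMoment_add_toEuclideanLin_self
      (h.memLp_of_mem (h.noise_mem k hk)) (h.memLp_state (Nat.le_of_succ_le hk)) hxw,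
      h.crossMoment_noise k hk, ih (Nat.le_of_succ_le hk), add_comm, stateCov]

end IsLinearGaussianState

end SignalingGame

section Filter

variable {m p : ℕ} {A : Matrix (Fin p) (Fin p) ℝ} {K : ℕ → Matrix (Fin p) (Fin p) ℝ}

/-- The recursive linear estimate of the current state from the states at stages `1, …, k`: the
prediction `A z` is corrected by the multiple `K k` of the innovation. -/
noncomputable def filterEst (A : Matrix (Fin p) (Fin p) ℝ) (K : ℕ → Matrix (Fin p) (Fin p) ℝ) :
    ∀ k : ℕ, (Fin k → EuclideanSpace ℝ (Fin p)) → EuclideanSpace ℝ (Fin p)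
  | 0, _ => 0
  | k + 1, f => Matrix.toEuclideanLin A (filterEst A K k (Fin.init f)) +
      Matrix.toEuclideanLin (K (k + 1))
        (f (Fin.last k) - Matrix.toEuclideanLin A (filterEst A K k (Fin.init f)))

lemma measurable_filterEst (A : Matrix (Fin p) (Fin p) ℝ) (K : ℕ → Matrix (Fin p) (Fin p) ℝ)
    (k : ℕ) : Measurable (filterEst A K k) := by
  induction k with
  | zero => exact measurable_const
  | succ k ih =>
    have hinit : Measurable fun f : Fin (k + 1) → EuclideanSpace ℝ (Fin p) => Fin.init f :=
      measurable_pi_lambda _ fun l => measurable_pi_apply _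
    have hpred := (continuous_toEuclideanLin A).measurable.comp (ih.comp hinit)
    exact hpred.add ((continuous_toEuclideanLin (K (k + 1))).measurable.comp
      ((measurable_pi_apply _).sub hpred))

/-- The sender policy that reports the filtered state. -/
noncomputable def filterPolicy (A : Matrix (Fin p) (Fin p) ℝ)
    (K : ℕ → Matrix (Fin p) (Fin p) ℝ) : SenderPolicy p :=
  fun k => ⟨filterEst A K k, measurable_filterEst A K k⟩

variable {Ω : Type*}

/-- The process of filtered states. -/
noncomputable def filtered (A : Matrix (Fin p) (Fin p) ℝ) (K : ℕ → Matrix (Fin p) (Fin p) ℝ)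
    (x : ℕ → Ω → EuclideanSpace ℝ (Fin p)) (k : ℕ) (ω : Ω) : EuclideanSpace ℝ (Fin p) :=
  filterEst A K k fun l => x (l + 1) ω

variable {x : ℕ → Ω → EuclideanSpace ℝ (Fin p)}

lemma filtered_zero : filtered A K x 0 = 0 := rfl

lemma filtered_succ (k : ℕ) : filtered A K x (k + 1) = Matrix.toEuclideanLin A ∘ filtered A K x k +
    Matrix.toEuclideanLin (K (k + 1)) ∘ (x (k + 1) - Matrix.toEuclideanLin A ∘ filtered A K x k) :=
  rfl

lemma measurable_filtered_receiverInfo (hm : 0 < m) (k : ℕ) :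
    Measurable[receiverInfo x (fun _ : Fin m => filterPolicy A K) k] (filtered A K x k) := by
  cases k with
  | zero => exact measurable_const
  | succ k =>
    exact ((measurable_pi_apply ⟨0, hm⟩).comp (measurable_pi_apply (Fin.last k))).comp
      (comap_measurable (messages x (fun _ : Fin m => filterPolicy A K) (k + 1)))

end Filter

namespace SignalingGame

variable {m p t q : ℕ} {G : SignalingGame m p t q} {Ω F : Type*} [MeasurableSpace Ω]
  {μ : Measure Ω} [NormedAddCommGroup F] [NormedSpace ℝ F] [MeasurableSpace F]
  {x w : ℕ → Ω → EuclideanSpace ℝ (Fin p)} {Z : Ω → F} {S K : ℕ → Matrix (Fin p) (Fin p) ℝ} {k : ℕ}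

/-- The gains `K k` make each correction of the filter have covariance `S k - A S (k-1) Aᵀ`, and
leave an error uncorrelated with the correction. -/
structure IsGainFor (G : SignalingGame m p t q) (S K : ℕ → Matrix (Fin p) (Fin p) ℝ) : Prop where
  mul_transpose : ∀ k < G.n,
    G.priorCov (k + 1) (S k) * (K (k + 1))ᵀ = S (k + 1) - G.A * S k * G.Aᵀ
  mul_mul_transpose : ∀ k < G.n, K (k + 1) * G.priorCov (k + 1) (S k) * (K (k + 1))ᵀ =
    S (k + 1) - G.A * S k * G.Aᵀ

lemma IsGreedy.exists_isGainFor {σ : ℕ → Equiv.Perm (Fin m)} (h : G.IsGreedy σ S) :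
    ∃ K, G.IsGainFor S K := by
  have mem_Icc {k} (hk : k < G.n) : k + 1 ∈ Finset.Icc 1 G.n := Finset.mem_Icc.2 ⟨k.succ_pos, hk⟩
  refine ⟨fun k => kalmanGain (G.priorCov k (S (k - 1))) (S k - G.A * S (k - 1) * G.Aᵀ),
    fun k hk => ?_, fun k hk => ?_⟩ <;>
  have hs := h.isSequentialPosterior (mem_Icc hk) <;>
  have hle := hs.le (h.priorCov_nonneg (mem_Icc hk))
  · exact mul_kalmanGain_transpose hs.nonneg hle
  · exact kalmanGain_mul_mul_transpose hs.nonneg hle hs.isStarProjection_whiten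

namespace IsLinearGaussianState

lemma filtered_mem (h : G.IsLinearGaussianState μ x w Z) (hk : k ≤ G.n) :
    filtered G.A K x k ∈ linearFunctions Z (EuclideanSpace ℝ (Fin p)) := by
  induction k with
  | zero => exact zero_mem _
  | succ k ih =>
    have hpred := toEuclideanLin_comp_mem_linearFunctions (ih (Nat.le_of_succ_le hk)) G.A
    exact add_mem hpred
      (toEuclideanLin_comp_mem_linearFunctions (sub_mem (h.state_mem hk) hpred) (K (k + 1)))

lemma innovation_eq (h : G.IsLinearGaussianState μ x w Z) (hk : k < G.n) :
    x (k + 1) - Matrix.toEuclideanLin G.A ∘ filtered G.A K x k =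
      w k + Matrix.toEuclideanLin G.A ∘ (x k - filtered G.A K x k) := by
  ext1 ω
  simp only [h.step k hk, Pi.sub_apply, Pi.add_apply, Function.comp_apply, map_sub]
  abel

variable [BorelSpace F]

lemma memLp_filtered (h : G.IsLinearGaussianState μ x w Z) (hk : k ≤ G.n) :
    MemLp (filtered G.A K x k) 2 μ :=
  h.memLp_of_mem (h.filtered_mem hk)

lemma crossMoment_filtered_eq_zero {Y : Ω → EuclideanSpace ℝ (Fin p)}
    (h : G.IsLinearGaussianState μ x w Z) (hY : MemLp Y 2 μ) (hk : k ≤ G.n)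
    (hYx : ∀ l ≤ k, crossMoment μ Y (x l) = 0) : crossMoment μ Y (filtered G.A K x k) = 0 := by
  induction k with
  | zero => rw [filtered_zero, crossMoment_zero_right]
  | succ k ih =>
    have hz := h.memLp_filtered (K := K) (Nat.le_of_succ_le hk)
    have hpred := memLp_toEuclideanLin hz G.A
    have hinnov := (h.memLp_state hk).sub hpred
    have hYpred : crossMoment μ Y (Matrix.toEuclideanLin G.A ∘ filtered G.A K x k) = 0 := by
      rw [crossMoment_toEuclideanLin_right hY hz, ih (by omega) fun l hl => hYx l (by omega),
        Matrix.zero_mul]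
    rw [filtered_succ, crossMoment_add_right hY hpred (memLp_toEuclideanLin hinnov _),
      crossMoment_toEuclideanLin_right hY hinnov, crossMoment_sub_right hY (h.memLp_state hk) hpred,
      hYx _ le_rfl, hYpred, sub_zero, Matrix.zero_mul, add_zero]

lemma crossMoment_noise_filtered (h : G.IsLinearGaussianState μ x w Z) (hk : k < G.n) {l : ℕ}
    (hl : l ≤ k) : crossMoment μ (w k) (filtered G.A K x l) = 0 :=
  h.crossMoment_filtered_eq_zero (h.memLp_of_mem (h.noise_mem k hk)) (hl.trans hk.le)
    fun _ hj => h.crossMoment_noise_state hk (hj.trans hl)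

lemma crossMoment_innovation_filtered (h : G.IsLinearGaussianState μ x w Z) (hk : k < G.n) {l : ℕ}
    (hl : l ≤ k) (horth : crossMoment μ (x k - filtered G.A K x k) (filtered G.A K x l) = 0) :
    crossMoment μ (x (k + 1) - Matrix.toEuclideanLin G.A ∘ filtered G.A K x k)
      (filtered G.A K x l) = 0 := by
  have hε := (h.memLp_state hk.le).sub (h.memLp_filtered (K := K) hk.le)
  have hz := h.memLp_filtered (K := K) (hl.trans hk.le)
  rw [h.innovation_eq hk, crossMoment_add_left (h.memLp_of_mem (h.noise_mem k hk))
    (memLp_toEuclideanLin hε _) hz, crossMoment_toEuclideanLin_left hε hz, horth,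
    h.crossMoment_noise_filtered hk hl, Matrix.mul_zero, add_zero]

lemma crossMoment_innovation_self (h : G.IsLinearGaussianState μ x w Z) (hk : k < G.n)
    (horth : crossMoment μ (x k - filtered G.A K x k) (filtered G.A K x k) = 0) :
    crossMoment μ (x (k + 1) - Matrix.toEuclideanLin G.A ∘ filtered G.A K x k)
        (x (k + 1) - Matrix.toEuclideanLin G.A ∘ filtered G.A K x k) =
      G.priorCov (k + 1) (crossMoment μ (filtered G.A K x k) (filtered G.A K x k)) := by
  have hx := h.memLp_state hk.le
  have hz := h.memLp_filtered (K := K) hk.le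
  have hw := h.memLp_of_mem (h.noise_mem k hk)
  have hεw : crossMoment μ (x k - filtered G.A K x k) (w k) = 0 := by
    rw [← crossMoment_transpose, crossMoment_sub_right hw hx hz,
      h.crossMoment_noise_state hk le_rfl, h.crossMoment_noise_filtered hk le_rfl, sub_zero,
      Matrix.transpose_zero]
  rw [h.innovation_eq hk, crossMoment_add_toEuclideanLin_self hw (hx.sub hz) hεw,
    h.crossMoment_noise k hk, crossMoment_sub_self_of_orthogonal hx hz horth,
    h.crossMoment_state hk.le, priorCov, stateCov, mul_sub, sub_mul]
  abel

/-- The two properties of the filter are proved together: the covariance of the innovation at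
stage `k + 1` is determined by both of them at stage `k`. -/
lemma crossMoment_filtered (h : G.IsLinearGaussianState μ x w Z) (hS : S 0 = 0)
    (hK : G.IsGainFor S K) (hk : k ≤ G.n) :
    (∀ l ≤ k, crossMoment μ (x k - filtered G.A K x k) (filtered G.A K x l) = 0) ∧
      crossMoment μ (filtered G.A K x k) (filtered G.A K x k) = S k := by
  induction k with
  | zero =>
    refine ⟨fun l hl => ?_, by rw [filtered_zero, crossMoment_zero_right, hS]⟩
    rw [Nat.le_zero.1 hl, filtered_zero, crossMoment_zero_right]
  | succ k ih =>
    obtain ⟨horth, hcov⟩ := ih (Nat.le_of_succ_le hk)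
    have hz := h.memLp_filtered (K := K) (Nat.le_of_succ_le hk)
    have hpred := memLp_toEuclideanLin hz G.A
    let Y := x (k + 1) - Matrix.toEuclideanLin G.A ∘ filtered G.A K x k
    have hY : MemLp Y 2 μ := (h.memLp_state hk).sub hpred
    have hKY := memLp_toEuclideanLin hY (K (k + 1))
    have hYY : crossMoment μ Y Y = G.priorCov (k + 1) (S k) := by
      rw [h.crossMoment_innovation_self hk (horth k le_rfl), hcov]
    have hYz (l) (hl : l ≤ k) : crossMoment μ Y (filtered G.A K x l) = 0 :=
      h.crossMoment_innovation_filtered hk hl (horth l hl)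
    have hYpred : crossMoment μ Y (Matrix.toEuclideanLin G.A ∘ filtered G.A K x k) = 0 := by
      rw [crossMoment_toEuclideanLin_right hY hz, hYz k le_rfl, Matrix.zero_mul]
    have hερ : x (k + 1) - filtered G.A K x (k + 1) =
        Y - Matrix.toEuclideanLin (K (k + 1)) ∘ Y := sub_add_eq_sub_sub _ _ _
    refine ⟨fun l hl => ?_, ?_⟩
    · rw [hερ]
      obtain rfl | hl := hl.eq_or_lt
      · refine crossMoment_sub_toEuclideanLin_update hpred hY hYpred ?_
        rw [hYY, hK.mul_mul_transpose k hk, hK.mul_transpose k hk]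
      · have hzl := h.memLp_filtered (K := K) (hl.le.trans hk)
        rw [crossMoment_sub_left hY hKY hzl, crossMoment_toEuclideanLin_left hY hzl,
          hYz l (Nat.le_of_lt_succ hl), Matrix.mul_zero, sub_zero]
    · refine (crossMoment_add_toEuclideanLin_self hpred hY hYpred _).trans ?_
      rw [hYY, hK.mul_mul_transpose k hk, crossMoment_toEuclideanLin_self hz, hcov, add_sub_cancel]

variable [CompleteSpace F] [SecondCountableTopology F]

lemma indepFun_filter_error (h : G.IsLinearGaussianState μ x w Z) (hS : S 0 = 0)
    (hK : G.IsGainFor S K) (hk : k ≤ G.n) :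
    IndepFun (x k - filtered G.A K x k) (messages x (fun _ : Fin m => filterPolicy G.A K) k) μ := by
  have hind := indepFun_of_crossMoment_eq_zero (Y := fun l : Fin k => filtered G.A K x (l + 1))
    (sub_mem (h.state_mem hk) (h.filtered_mem hk)) (fun l => h.filtered_mem (by omega))
    h.hasGaussianLaw h.measurable h.integral_eq_zero
    fun l => (h.crossMoment_filtered hS hK hk).1 _ (by omega)
  exact hind.comp measurable_id
    (measurable_pi_lambda _ fun l => measurable_pi_lambda _ fun _ => measurable_pi_apply l)

lemma estimate_filterPolicy [IsFiniteMeasure μ] (h : G.IsLinearGaussianState μ x w Z) (hm : 0 < m)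
    (hS : S 0 = 0) (hK : G.IsGainFor S K) (hk : k ≤ G.n) :
    estimate μ x (fun _ : Fin m => filterPolicy G.A K) k =ᵐ[μ] filtered G.A K x k := by
  set η : SenderProfile m p := fun _ => filterPolicy G.A K
  have hle := receiverInfo_le (η := η) fun l hl => h.measurable_state (hl.trans hk)
  have hx := (h.memLp_state hk).integrable (by norm_num)
  have hz := (h.memLp_filtered (K := K) hk).integrable (by norm_num)
  have hε := sub_mem (h.state_mem hk) (h.filtered_mem (K := K) hk)
  have hεm := measurable_of_mem_linearFunctions hε h.measurable
  have hcond : μ[x k - filtered G.A K x k | receiverInfo x η k] =ᵐ[μ] 0 := by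
    refine (condExp_indep_eq hεm.comap_le hle (comap_measurable _).stronglyMeasurable
      (h.indepFun_filter_error hS hK hk)).trans (.of_eq ?_)
    exact funext fun _ => integral_eq_zero_of_mem_linearFunctions hε h.hasGaussianLaw
      h.integral_eq_zero
  have hsub := condExp_sub hx hz (receiverInfo x η k)
  rw [condExp_of_stronglyMeasurable hle
    (measurable_filtered_receiverInfo hm k).stronglyMeasurable hz] at hsub
  filter_upwards [hsub, hcond] with ω h₁ h₂
  exact sub_eq_zero.1 (h₁.symm.trans h₂)

lemma posteriorCov_filterPolicy [IsFiniteMeasure μ] (h : G.IsLinearGaussianState μ x w Z)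
    (hm : 0 < m) (hS : S 0 = 0) (hK : G.IsGainFor S K) (hk : k ≤ G.n) :
    posteriorCov μ x (fun _ : Fin m => filterPolicy G.A K) k = S k :=
  (crossMoment_congr (h.estimate_filterPolicy hm hS hK hk)
    (h.estimate_filterPolicy hm hS hK hk)).trans (h.crossMoment_filtered hS hK hk).2

end IsLinearGaussianState

end SignalingGame

/-! ### Equilibrium -/

lemma receiverInfo_mono {Ω : Type*} {m p : ℕ} (x : ℕ → Ω → EuclideanSpace ℝ (Fin p))
    {η η' : SenderProfile m p} (h : ∀ i, ∃ j, η i = η' j) (k : ℕ) :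
    receiverInfo x η k ≤ receiverInfo x η' k := by
  choose f hf using h
  have hmsg : messages x η k = (fun y l i => y l (f i)) ∘ messages x η' k := by
    funext ω l i
    simp only [messages, Function.comp_apply]
    rw [hf i]
  rw [receiverInfo, hmsg, ← MeasurableSpace.comap_comp]
  refine MeasurableSpace.comap_mono (Measurable.comap_le ?_)
  exact measurable_pi_lambda _ fun l => measurable_pi_lambda _ fun i =>
    (measurable_pi_apply (f i)).comp (measurable_pi_apply l)

namespace SignalingGame

variable {m p t q : ℕ} {G : SignalingGame m p t q} {Ω F : Type*} [MeasurableSpace Ω]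
  {μ : Measure Ω} [IsFiniteMeasure μ] [NormedAddCommGroup F] [NormedSpace ℝ F] [MeasurableSpace F]
  [BorelSpace F] {x w : ℕ → Ω → EuclideanSpace ℝ (Fin p)} {Z : Ω → F} {η : SenderProfile m p}
  {g g' : ReceiverPolicy m p t} {i j : Fin m} {e : SenderPolicy p} {k : ℕ} {s : Finset ℕ}

/-- Since sender `j` keeps sending the messages of sender `i`, a deviation of sender `i` can only
increase the posterior covariance, and stage-stability applies. -/
lemma IsStageStable.stageCost_le_update (hstable : G.IsStageStable i k (posteriorCov μ x η k))
    (h : G.IsLinearGaussianState μ x w Z) (hk : k ≤ G.n) (hji : j ≠ i) (hη : η i = η j)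
    (hg : G.RespondsTo μ x η g) (hg' : G.RespondsTo μ x (Function.update η i e) g') :
    G.stageCost μ x (some i) k η g ≤
      G.stageCost μ x (some i) k (Function.update η i e) g' := by
  have hm : ∀ l ≤ k, Measurable (x l) := fun l hl => h.measurable_state (hl.trans hk)
  have hx := h.memLp_state hk
  have hkept (i') : ∃ j', η i' = Function.update η i e j' := by
    obtain rfl | hi' := eq_or_ne i' i
    · exact ⟨j, by rw [Function.update_of_ne hji, hη]⟩
    · exact ⟨i', by rw [Function.update_of_ne hi']⟩
  have hmono := posteriorCov_mono hm hx (receiverInfo_mono x hkept k)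
  have hle := h.crossMoment_state hk ▸ posteriorCov_le (η := Function.update η i e) hm hx
  rw [hg.stageCost_sender hm hx i, hg'.stageCost_sender hm hx i]
  exact ENNReal.ofReal_le_ofReal (add_le_add le_rfl (hstable.2.2.2 _ hmono hle))

lemma IsLinearGaussianState.cost_le_update (h : G.IsLinearGaussianState μ x w Z)
    (hs : s ⊆ Finset.Icc 1 G.n) (hstable : ∀ k ∈ s, G.IsStageStable i k (posteriorCov μ x η k))
    (hji : j ≠ i) (hη : η i = η j) (hg : G.RespondsTo μ x η g)
    (hg' : G.RespondsTo μ x (Function.update η i e) g') :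
    G.cost μ x (some i) s η g ≤ G.cost μ x (some i) s (Function.update η i e) g' := by
  have hsn : ∀ k ∈ s, k ≤ G.n := fun k hk => (Finset.mem_Icc.1 (hs hk)).2
  rw [cost_eq_sum_stageCost (fun _ => h.measurable_state) _ hsn,
    cost_eq_sum_stageCost (fun _ => h.measurable_state) _ hsn]
  exact Finset.sum_le_sum fun k hk =>
    (hstable k hk).stageCost_le_update h (hsn k hk) hji hη hg hg'

lemma RespondsTo.cost_receiver_le (hg : G.RespondsTo μ x η g)
    (h : G.IsLinearGaussianState μ x w Z) (hs : s ⊆ Finset.Icc 1 G.n) :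
    G.cost μ x none s η g ≤ G.cost μ x none s η g' := by
  have hsn : ∀ k ∈ s, k ≤ G.n := fun k hk => (Finset.mem_Icc.1 (hs hk)).2
  rw [cost_eq_sum_stageCost (fun _ => h.measurable_state) _ hsn,
    cost_eq_sum_stageCost (fun _ => h.measurable_state) _ hsn]
  exact Finset.sum_le_sum fun k hk => hg.stageCost_receiver_le (hs hk)
    (fun l hl => h.measurable_state (hl.trans (hsn k hk))) (h.memLp_state (hsn k hk)) g'

lemma IsGreedy.exists_isEquilibrium [CompleteSpace F] [SecondCountableTopology F]
    {σ : ℕ → Equiv.Perm (Fin m)} {S : ℕ → Matrix (Fin p) (Fin p) ℝ} (hS : G.IsGreedy σ S)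
    (h : G.IsLinearGaussianState μ x w Z) (hm : 2 ≤ m) :
    ∃ (η : SenderProfile m p) (γ : SenderProfile m p → ReceiverPolicy m p t),
      G.IsEquilibrium μ x η γ ∧
      (∀ k ∈ Finset.Icc 1 G.n, posteriorCov μ x η k = S k) ∧
      (∀ k ∈ Finset.Icc 1 G.n, ∀ (i : Fin m) (e : SenderPolicy p),
        G.cost μ x (some i) (Finset.Icc k G.n) η (γ η) ≤
          G.cost μ x (some i) (Finset.Icc k G.n) (Function.update η i e)
            (γ (Function.update η i e))) := by
  obtain ⟨K, hK⟩ := hS.exists_isGainFor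
  choose γ hγ using G.exists_respondsTo μ x
  let η : SenderProfile m p := fun _ => filterPolicy G.A K
  have hpost : ∀ k ∈ Finset.Icc 1 G.n, posteriorCov μ x η k = S k := fun k hk =>
    h.posteriorCov_filterPolicy (by omega) hS.1 hK (Finset.mem_Icc.1 hk).2
  have hstable : ∀ k ∈ Finset.Icc 1 G.n, ∀ i, G.IsStageStable i k (posteriorCov μ x η k) :=
    fun k hk i => (hpost k hk).symm ▸ hS.isStageStable hk i
  have hdev (s) (hs : s ⊆ Finset.Icc 1 G.n) (i : Fin m) (e : SenderPolicy p) :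
      G.cost μ x (some i) s η (γ η) ≤
        G.cost μ x (some i) s (Function.update η i e) (γ (Function.update η i e)) := by
    have : Nontrivial (Fin m) := Fin.nontrivial_iff_two_le.2 hm
    obtain ⟨j, hji⟩ := exists_ne i
    exact h.cost_le_update hs (fun k hk => hstable k (hs hk) i) hji rfl (hγ _) (hγ _)
  have hinit (k) (hk : k ∈ Finset.Icc 1 G.n) : Finset.Icc 1 k ⊆ Finset.Icc 1 G.n :=
    Finset.Icc_subset_Icc_right (Finset.mem_Icc.1 hk).2
  exact ⟨η, γ, ⟨fun k hk η' g => (hγ η').cost_receiver_le h (hinit k hk),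
    fun k hk => hdev _ (hinit k hk)⟩, hpost,
    fun k hk => hdev _ (Finset.Icc_subset_Icc_left (Finset.mem_Icc.1 hk).1)⟩

end SignalingGame

theorem lemma8 {m p t q : ℕ} (hm : 2 ≤ m) (G : SignalingGame m p t q)
    {Ω : Type*} [MeasurableSpace Ω] (μ : Measure Ω) [IsProbabilityMeasure μ]
    (x : ℕ → Ω → EuclideanSpace ℝ (Fin p)) (hx : G.IsGaussMarkovState μ x) :
    (∀ σ : ℕ → Equiv.Perm (Fin m), ∃ S, G.IsGreedy σ S) ∧
    (∀ (σ : ℕ → Equiv.Perm (Fin m)) (S : ℕ → Matrix (Fin p) (Fin p) ℝ), G.IsGreedy σ S →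
      (∃ P : ℕ → Matrix (Fin p) (Fin p) ℝ, ∀ k ∈ Finset.Icc 1 G.n, IsStarProjection (P k) ∧
        S k = G.A * S (k - 1) * G.Aᵀ +
          CFC.sqrt (G.stateCov k - G.A * S (k - 1) * G.Aᵀ) * P k *
            CFC.sqrt (G.stateCov k - G.A * S (k - 1) * G.Aᵀ)) ∧
      (∃ (η : SenderProfile m p) (γ : SenderProfile m p → ReceiverPolicy m p t),
        G.IsEquilibrium μ x η γ ∧
        (∀ k ∈ Finset.Icc 1 G.n, posteriorCov μ x η k = S k) ∧
        (∀ k ∈ Finset.Icc 1 G.n, ∀ (i : Fin m) (e : SenderPolicy p),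
          G.cost μ x (some i) (Finset.Icc k G.n) η (γ η) ≤
            G.cost μ x (some i) (Finset.Icc k G.n) (Function.update η i e)
              (γ (Function.update η i e)))) ∧
      (∀ k ∈ Finset.Icc 1 G.n, ∀ i : Fin m, G.IsStageStable i k (S k) ∧
        ∀ B, G.IsFloor B → G.IsCostToGoStable B i k (S k))) ∧
    (∀ k ∈ Finset.Icc 1 G.n, ∀ (i : Fin m) (T : Matrix (Fin p) (Fin p) ℝ),
      G.IsStageStable i k T → ∀ B, G.IsFloor B → G.IsCostToGoStable B i k T) := by
  refine ⟨G.exists_isGreedy, fun σ S hS => ⟨⟨G.stageProj S, fun k hk => ?_⟩, ?_, fun k hk i => ?_⟩,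
    fun k _ i T hT B hB => hT.isCostToGoStable hB⟩
  · exact ⟨hS.isStarProjection_stageProj hk, hS.eq_add_sqrt_conj hk⟩
  · obtain ⟨w, Z, h⟩ := hx.exists_isLinearGaussianState
    exact hS.exists_isEquilibrium h hm
  · exact ⟨hS.isStageStable hk i, fun B hB => (hS.isStageStable hk i).isCostToGoStable hB⟩
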